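/- **Setting.** Let $\mathcal G=(\mathcal N,\mathcal E)$, $\mathcal N=\{1,\dots,N\}$, be a connected simple undirected graph whose edges $(i,j)\in\mathcal E$ are written with $i<j$; let $\mathcal N_i$ be the set of neighbours and $d_i=|\mathcal N_i|$ the degree of $i$. For $i\in\mathcal N$ let $\Phi_i=\xi_i+f_i$, where $\xi_i:\mathbb R^n\to\mathbb R\cup\{+\infty\}$ is closed and convex, $f_i:\mathbb R^n\to\mathbb R$ is convex, and $f_i$ is differentiable with $L_i$-Lipschitz gradient ($L_i\ge 0$) on an open set $U_i\supseteq\operatorname{dom}\xi_i$. Put $F(\mathbf x)=\sum_{i}\Phi_i(x_i)$ for $\mathbf x=(x_i)_{i\in\mathcal N}\in(\mathbb R^n)^N$, and $F^*=\min_{x\in\mathbb R^n}\sum_i\Phi_i(x)$. The distributed problem is to minimize $F(\mathbf x)$ subject to $x_i=x_j$ for all $(i,j)\in\mathcal E$. **Algorithm (DPGA).** Let $\gamma_i>0$ and $c_i>0$ for $i\in\mathcal N$, and put $\Gamma_{ij}=-\frac{\gamma_i\gamma_j}{\gamma_i+\gamma_j}$ for $j\in\mathcal N_i$, $\Gamma_{ii}=\sum_{j\in\mathcal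 N_i}\frac{\gamma_i\gamma_j}{\gamma_i+\gamma_j}$, and $\Gamma_{ij}=0$ otherwise. From starting points $x_i^0\in\mathbb R^n$, with $p_i^0=0$ and $s_i^0=\sum_{j\in\mathcal N_i\cup\{i\}}\Gamma_{ij}x_j^0$, compute for $k\ge 0$ and all $i\in\mathcal N$ $$x_i^{k+1}=\operatorname{prox}_{c_i\xi_i}\!\big(x_i^k-c_i(\nabla f_i(x_i^k)+p_i^k+s_i^k)\big),\quad s_i^{k+1}=\sum_{j\in\mathcal N_i\cup\{i\}}\Gamma_{ij}x_j^{k+1},\quad p_i^{k+1}=p_i^k+s_i^{k+1},$$ where $\operatorname{prox}_{\varphi}(v)=\operatorname{argmin}_{y}\{\varphi(y)+\frac12\|y-v\|^2\}$. The starting points are arbitrary, except that for each $i$ the segments joining $x_i^0$ to the points of $\operatorname{dom}\xi_i$ lie in $U_i$ (this is automatic if $U_i=\mathbb R^n$, or if $x_i^0\in\operatorname{dom}\xi_i$). **Theorem.** Suppose that a minimizer $x^*\in\mathbb R^n$ of $\sum_i\Phi_i$ exists, that $\bigcap_{i\in\mathcal N}\operatorname{ri}(\operatorname{dom}\xi_i)\neq\emptyset$,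 and that $c_i(L_i+\gamma_id_i)\le 1$ for all $i\in\mathcal N$. Let $\bar x_i^t=\frac1t\sum_{k=1}^tx_i^k$ and $\bar{\mathbf x}^t=(\bar x_i^t)_{i\in\mathcal N}$ for $t\ge 1$. 1. If $c_i(L_i+\gamma_id_i)<1$ for all $i\in\mathcal N$, then $\mathbf x^k=(x_i^k)_{i\in\mathcal N}$ converges, as $k\to\infty$, to an optimal solution of the distributed problem. 2. For all $t\ge1$, $$F(\bar{\mathbf x}^t)-F^*\le\frac1t\sum_{i\in\mathcal N}\frac1{2c_i}\|x^*-x_i^0\|^2 .$$ 3. If $\kappa_i>0$ ($i\in\mathcal N$) are such that $\|q\|\le\kappa_i$ for every $q\in\partial\Phi_i(x^*)$, then for all $t\ge1$ $$F(\bar{\mathbf x}^t)-F^*\ge-\frac1t\Big(\frac{2\|Q\|}{\sigma_{\min}(\Omega)}\sum_{i\in\mathcal N}\kappa_i^2+\sum_{i\in\mathcal N}\frac1{2c_i}\|x^*-x_i^0\|^2\Big),$$ $$\Big(\sum_{(i,j)\in\mathcal E}\|\bar x_i^t-\bar x_j^t\|^2\Big)^{1/2}\le\frac1t\Big[\|Q\|\Big(\sum_{i\in\mathcal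 N}\frac{\kappa_i^2}{\sigma_{\min}(\Omega)}+1\Big)+\sum_{i\in\mathcal N}\frac1{2c_i}\|x^*-x_i^0\|^2\Big],$$ where $\|Q\|$ is the spectral norm of $Q=\operatorname{diag}\big([\frac1{\gamma_i}+\frac1{\gamma_j}]_{(i,j)\in\mathcal E}\big)$ and $\sigma_{\min}(\Omega)$ is the smallest nonzero eigenvalue of the Laplacian $\Omega$ of $\mathcal G$. (If $N=1$, there are no edges, and the terms containing $\|Q\|$ are read as $0$.) -/

import Mathlib

open scoped NNReal

noncomputable section

namespace DPGA

/-- `ℝⁿ` with its Euclidean norm. -/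
abbrev Vec (n : ℕ) : Type := EuclideanSpace ℝ (Fin n)

/-! ### Extended-valued convex functions -/

/-- The effective domain of an extended-valued function. -/
def effDom {n : ℕ} (φ : Vec n → EReal) : Set (Vec n) := {x | φ x ≠ ⊤}

/-- The epigraph of an extended-valued function, a subset of `ℝⁿ × ℝ`. -/
def epigraph {n : ℕ} (φ : Vec n → EReal) : Set (Vec n × ℝ) := {p | φ p.1 ≤ (p.2 : EReal)}

/-- A function `ℝⁿ → ℝ ∪ {+∞}` that is convex and closed (lower semicontinuous). -/
structure IsClosedConvex {n : ℕ} (φ : Vec n → EReal) : Prop where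
  ne_bot : ∀ x, φ x ≠ ⊥
  convex : Convex ℝ (epigraph φ)
  closed : LowerSemicontinuous φ

/-- The convex subdifferential `∂φ(x)`. -/
def subdifferential {n : ℕ} (φ : Vec n → EReal) (x : Vec n) : Set (Vec n) :=
  {q | ∀ y, φ x + ((inner ℝ q (y - x) : ℝ) : EReal) ≤ φ y}

/-- `z = prox_{cφ}(v)`: the point `z` minimizes `y ↦ c φ(y) + ½ ‖y - v‖²`. -/
def IsProx {n : ℕ} (c : ℝ) (φ : Vec n → EReal) (v z : Vec n) : Prop :=
  ∀ y, (c : EReal) * φ z + ((1 / 2 * ‖z - v‖ ^ 2 : ℝ) : EReal) ≤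
    (c : EReal) * φ y + ((1 / 2 * ‖y - v‖ ^ 2 : ℝ) : EReal)

/-- The standing assumption on one pair `(ξ, f)`: `ξ` is closed convex with values in
`ℝ ∪ {+∞}`, `f` is real-valued and convex, and `f` is differentiable with `L`-Lipschitz gradient
on the open set `U`, which contains the domain of `ξ`. -/
structure IsCompositePair {n : ℕ} (ξ : Vec n → EReal) (f : Vec n → ℝ) (U : Set (Vec n))
    (L : ℝ≥0) : Prop where
  nonsmooth : IsClosedConvex ξ
  smooth_convex : ConvexOn ℝ Set.univ f
  isOpen : IsOpen U
  dom_subset : effDom ξ ⊆ U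
  differentiable : ∀ x ∈ U, DifferentiableAt ℝ f x
  lipschitz : LipschitzOnWith L (gradient f) U

/-! ### The consensus problem -/

/-- `Φ = ξ + f`. -/
def composite {n : ℕ} (ξ : Vec n → EReal) (f : Vec n → ℝ) (x : Vec n) : EReal :=
  ξ x + (f x : EReal)

/-- The separable objective `F(𝐱) = ∑ᵢ Φᵢ(xᵢ)`. -/
def objective {N n : ℕ} (ξ : Fin N → Vec n → EReal) (f : Fin N → Vec n → ℝ)
    (x : Fin N → Vec n) : EReal :=
  ∑ i, composite (ξ i) (f i) (x i)

/-- The optimal value `F* = inf_x ∑ᵢ Φᵢ(x)` of the centralized problem. -/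
def optValue {N n : ℕ} (ξ : Fin N → Vec n → EReal) (f : Fin N → Vec n → ℝ) : EReal :=
  ⨅ x : Vec n, ∑ i, composite (ξ i) (f i) x

/-- `x` solves the centralized problem `min_x ∑ᵢ Φᵢ(x)`. -/
def IsCentralSolution {N n : ℕ} (ξ : Fin N → Vec n → EReal) (f : Fin N → Vec n → ℝ)
    (x : Vec n) : Prop :=
  ∀ y, ∑ i, composite (ξ i) (f i) x ≤ ∑ i, composite (ξ i) (f i) y

/-- `x` satisfies the consensus constraints `xᵢ = xⱼ` along the edges of `G`. -/
def IsConsensus {N n : ℕ} (G : SimpleGraph (Fin N)) (x : Fin N → Vec n) : Prop :=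
  ∀ i j, G.Adj i j → x i = x j

/-- `x` solves the distributed problem `min {F(𝐱) : xᵢ = xⱼ for all edges (i, j)}`. -/
def IsDistributedSolution {N n : ℕ} (G : SimpleGraph (Fin N)) (ξ : Fin N → Vec n → EReal)
    (f : Fin N → Vec n → ℝ) (x : Fin N → Vec n) : Prop :=
  IsConsensus G x ∧ ∀ y, IsConsensus G y → objective ξ f x ≤ objective ξ f y

/-! ### Graph quantities -/

/-- The edges of `G`, oriented from the smaller to the larger endpoint. -/
abbrev OrientedEdge {N : ℕ} (G : SimpleGraph (Fin N)) : Type :=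
  {e : Fin N × Fin N // e.1 < e.2 ∧ G.Adj e.1 e.2}

/-- The diagonal matrix `Q = diag([1/γᵢ + 1/γⱼ]_{(i,j) ∈ E})`. -/
def edgeMatrix {N : ℕ} (G : SimpleGraph (Fin N)) (γ : Fin N → ℝ) :
    Matrix (OrientedEdge G) (OrientedEdge G) ℝ :=
  Matrix.diagonal fun e => 1 / γ e.1.1 + 1 / γ e.1.2

/-- The spectral norm `‖Q‖`. -/
def edgeMatrixNorm {N : ℕ} (G : SimpleGraph (Fin N)) [DecidableRel G.Adj] (γ : Fin N → ℝ) : ℝ :=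
  ‖Matrix.toEuclideanCLM (n := OrientedEdge G) (𝕜 := ℝ) (edgeMatrix G γ)‖

/-- `σ_min(Ω)`, the smallest nonzero eigenvalue of the Laplacian `Ω` of `G`. For a connected graph
on at least two vertices this is an attained, positive minimum. -/
def sigmaMin {N : ℕ} (G : SimpleGraph (Fin N)) [DecidableRel G.Adj] : ℝ :=
  sInf {μ : ℝ | μ ≠ 0 ∧ Module.End.HasEigenvalue (Matrix.toLin' (G.lapMatrix ℝ)) μ}

/-! ### The algorithm -/

/-- The weights `Γᵢⱼ`. -/
def weight {N : ℕ} (G : SimpleGraph (Fin N)) [DecidableRel G.Adj] (γ : Fin N → ℝ) (i j : Fin N) :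
    ℝ :=
  if i = j then ∑ l ∈ G.neighborFinset i, γ i * γ l / (γ i + γ l)
  else if G.Adj i j then -(γ i * γ j / (γ i + γ j))
  else 0

/-- `x, s, p` are sequences produced by DPGA from the starting point `x0` with penalty parameters
`γ` and step sizes `c`. -/
structure IsDPGA {N n : ℕ} (G : SimpleGraph (Fin N)) [DecidableRel G.Adj]
    (ξ : Fin N → Vec n → EReal) (f : Fin N → Vec n → ℝ) (γ c : Fin N → ℝ) (x0 : Fin N → Vec n)
    (x s p : ℕ → Fin N → Vec n) : Prop where
  x_zero : x 0 = x0
  s_zero : ∀ i, s 0 i = ∑ j ∈ insert i (G.neighborFinset i), weight G γ i j • x 0 j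
  p_zero : ∀ i, p 0 i = 0
  x_succ : ∀ k i, IsProx (c i) (ξ i) (x k i - c i • (gradient (f i) (x k i) + p k i + s k i))
    (x (k + 1) i)
  s_succ : ∀ k i, s (k + 1) i =
    ∑ j ∈ insert i (G.neighborFinset i), weight G γ i j • x (k + 1) j
  p_succ : ∀ k i, p (k + 1) i = p k i + s (k + 1) i

/-- The ergodic average `x̄ᵢᵗ = (∑_{k=1}^t xᵢᵏ) / t`. -/
def average {N n : ℕ} (x : ℕ → Fin N → Vec n) (t : ℕ) (i : Fin N) : Vec n :=
  (t : ℝ)⁻¹ • ∑ k ∈ Finset.Icc 1 t, x k i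

/-- The consensus violation `(∑_{(i,j) ∈ E} ‖xᵢ - xⱼ‖²)^{1/2}`. -/
def consensusViolation {N n : ℕ} (G : SimpleGraph (Fin N)) [DecidableRel G.Adj]
    (x : Fin N → Vec n) : ℝ :=
  Real.sqrt (∑ e : OrientedEdge G, ‖x e.1.1 - x e.1.2‖ ^ 2)

/-- `∑ᵢ (1 / (2 cᵢ)) ‖x* - xᵢ⁰‖²`. -/
def initialGap {N n : ℕ} (c : Fin N → ℝ) (xstar : Vec n) (x0 : Fin N → Vec n) : ℝ :=
  ∑ i, 1 / (2 * c i) * ‖xstar - x0 i‖ ^ 2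

end DPGA

end

/-! The matrix `Γ` is a Laplacian of the graph with edge weights `γᵢγⱼ/(γᵢ+γⱼ)`, so it factors as
`Bᵀ B` with `B` a weighted incidence operator whose kernel is the consensus space. Since `p`
accumulates `Γ x`, the quantity `pᵏ + sᵏ` is `Bᵀ(B Pₖ + B xᵏ)` with `Pₖ = x¹ + ⋯ + xᵏ`. Hence DPGA
is a linearized augmented Lagrangian method for minimizing `F` subject to `B x = 0`, with dual
variable `B Pₖ`, proximal metric `diag(1/cᵢ)` and smoothness metric `diag(Lᵢ)`.

For feasible `y` and any `μ`, one step decreases `‖y - xᵏ‖² - ‖B xᵏ‖² + ‖B Pₖ - μ‖²` (first norm in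
the metric `1/cᵢ`) by at least twice the Lagrangian gap at `(y, μ)`, provided `1/cᵢ ≥ Lᵢ + γᵢdᵢ`;
this is `lyapunov_succ_le` together with `norm_sq_edgeOp_add_le`. Telescoping and Jensen give
`ergodic_bound`, in which `μ` is free: `μ = 0` yields the upper bound, twice a dual optimum the
lower bound, and a dual optimum plus the unit vector along the consensus error the feasibility
bound. Under strict inequality, monotonicity with respect to every saddle point gives convergence
(`exists_tendsto`).

The dual optimum is built in two stages. The relative interior condition yields subgradients `qᵢ` at
`x*` with sum zero (`exists_subgradients_sum_eq_zero`, through the M. Riesz extension theorem).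
Connectedness makes `-q` the divergence of an edge flow `θ` with `∑ ‖θ‖² ≤ ∑ ‖q‖² / σ_min`
(`exists_edge_flow`), and rescaling `θ` to pair with `B` costs the factor `‖Q‖`. -/

namespace DPGA

open Filter Topology

/-! ### Abstract analysis of the linearized primal-dual iteration. -/

section Abstract

variable {X E Y Z : Type*} [NormedAddCommGroup X] [NormedSpace ℝ X]
  [NormedAddCommGroup E] [InnerProductSpace ℝ E] [NormedAddCommGroup Y] [InnerProductSpace ℝ Y]
  [NormedAddCommGroup Z] [InnerProductSpace ℝ Z]

/-- The sum `x¹ + ⋯ + xᵏ` of the first `k` iterates. -/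
def partialSum (x : ℕ → X) (k : ℕ) : X := ∑ j ∈ Finset.Icc 1 k, x j

omit [NormedSpace ℝ X] in
lemma partialSum_succ (x : ℕ → X) (k : ℕ) :
    partialSum x (k + 1) = partialSum x k + x (k + 1) := by
  simp [partialSum, Finset.sum_Icc_succ_top]

omit [NormedSpace ℝ X] in
lemma partialSum_zero (x : ℕ → X) : partialSum x 0 = 0 := by simp [partialSum]

/-- A primal-dual proximal gradient sequence for minimizing `F` over `S` subject to `B y = 0`:
the iterates satisfy the variational inequality of a linearized augmented Lagrangian step whose
proximal metric is `Cᵀ C` and whose smoothness constant is measured by `Kᵀ K`. -/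
structure IsLinearizedStep (B : X →ₗ[ℝ] E) (C : X →ₗ[ℝ] Y) (K : X →ₗ[ℝ] Z) (S : Set X)
    (F : X → ℝ) (x : ℕ → X) : Prop where
  mem : ∀ k, x (k + 1) ∈ S
  le : ∀ k, ∀ y ∈ S, F (x (k + 1)) + inner ℝ (C (x k - x (k + 1))) (C (y - x (k + 1)))
    - inner ℝ (B (partialSum x k) + B (x k)) (B (y - x (k + 1)))
    - 1 / 2 * ‖K (x (k + 1) - x k)‖ ^ 2 ≤ F y

/-- The Lyapunov function of the iteration. -/
def lyapunov (B : X →ₗ[ℝ] E) (C : X →ₗ[ℝ] Y) (x : ℕ → X) (y : X) (μ : E) (k : ℕ) : ℝ :=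
  ‖C (y - x k)‖ ^ 2 - ‖B (x k)‖ ^ 2 + ‖B (partialSum x k) - μ‖ ^ 2

variable {B : X →ₗ[ℝ] E} {C : X →ₗ[ℝ] Y} {K : X →ₗ[ℝ] Z} {S : Set X} {F : X → ℝ} {x : ℕ → X}

/-- Twice the step inequality at `y`, with each inner product polarized into squares. The dual term
of the step uses `B (x k)` and not `B (x (k + 1))`; their cross term accounts for `-‖B (x k)‖ ^ 2`
in the Lyapunov function and for the loss `‖B (x (k + 1) - x k)‖ ^ 2`. -/
lemma IsLinearizedStep.lyapunov_succ_le (h : IsLinearizedStep B C K S F x) {y : X} (hy : y ∈ S)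
    (hBy : B y = 0) (μ : E) (k : ℕ) :
    2 * (F (x (k + 1)) - F y + inner ℝ μ (B (x (k + 1)))) + ‖B (x (k + 1))‖ ^ 2
      + (‖C (x (k + 1) - x k)‖ ^ 2 - ‖B (x (k + 1) - x k)‖ ^ 2 - ‖K (x (k + 1) - x k)‖ ^ 2)
      + lyapunov B C x y μ (k + 1) ≤ lyapunov B C x y μ k := by
  have h1 := h.le k y hy
  have e1 : ‖C (y - x k)‖ ^ 2 = ‖C (y - x (k + 1))‖ ^ 2 + ‖C (x (k + 1) - x k)‖ ^ 2
      - 2 * inner ℝ (C (x k - x (k + 1))) (C (y - x (k + 1))) := by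
    have : C (y - x k) = C (y - x (k + 1)) - C (x k - x (k + 1)) := by
      rw [← map_sub]; congr 1; abel
    have h' : C (x (k + 1) - x k) = - C (x k - x (k + 1)) := by rw [← map_neg]; congr 1; abel
    rw [this, h', norm_neg, norm_sub_sq_real, real_inner_comm]; ring
  have e2 : ‖B (partialSum x (k + 1)) - μ‖ ^ 2 = ‖B (partialSum x k) - μ‖ ^ 2
      + 2 * inner ℝ (B (partialSum x k)) (B (x (k + 1))) - 2 * inner ℝ μ (B (x (k + 1)))
      + ‖B (x (k + 1))‖ ^ 2 := by
    have : B (partialSum x (k + 1)) - μ = (B (partialSum x k) - μ) + B (x (k + 1)) := by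
      rw [partialSum_succ, map_add]; abel
    rw [this, norm_add_sq_real, inner_sub_left]; ring
  have e3 : ‖B (x (k + 1) - x k)‖ ^ 2 = ‖B (x (k + 1))‖ ^ 2
      - 2 * inner ℝ (B (x k)) (B (x (k + 1))) + ‖B (x k)‖ ^ 2 := by
    rw [map_sub, norm_sub_sq_real, real_inner_comm]
  have e4 : inner ℝ (B (partialSum x k) + B (x k)) (B (y - x (k + 1)))
      = - inner ℝ (B (partialSum x k)) (B (x (k + 1))) - inner ℝ (B (x k)) (B (x (k + 1))) := by
    rw [map_sub, hBy, zero_sub, inner_neg_right, inner_add_left]; ring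
  simp only [lyapunov]
  rw [e4] at h1
  linarith

/-- Feasibility of `y` makes the negative term equal to `‖B (y - x k)‖ ^ 2`, which the metric `C`
absorbs. -/
lemma sq_norm_le_lyapunov {ε : ℝ} (hCB : ∀ d, ε * ‖d‖ ^ 2 + ‖B d‖ ^ 2 ≤ ‖C d‖ ^ 2) {y : X}
    (hBy : B y = 0) (μ : E) (k : ℕ) :
    ε * ‖y - x k‖ ^ 2 + ‖B (partialSum x k) - μ‖ ^ 2 ≤ lyapunov B C x y μ k := by
  have h1 := hCB (y - x k)
  have : ‖B (y - x k)‖ = ‖B (x k)‖ := by rw [map_sub, hBy, zero_sub, norm_neg]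
  rw [this] at h1
  simp only [lyapunov]; linarith

/-- Telescoping of the Lyapunov decrease, then Jensen. No saddle point is involved, so `μ` can be
chosen afterwards, even depending on the average itself. -/
lemma IsLinearizedStep.ergodic_bound (h : IsLinearizedStep B C K S F x)
    (hCBK : ∀ d, ‖B d‖ ^ 2 + ‖K d‖ ^ 2 ≤ ‖C d‖ ^ 2) (hF : ConvexOn ℝ S F) {y : X} (hy : y ∈ S)
    (hBy : B y = 0) (μ : E) {t : ℕ} (ht : 1 ≤ t) :
    (t : ℝ)⁻¹ • ∑ k ∈ Finset.Icc 1 t, x k ∈ S ∧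
    F ((t : ℝ)⁻¹ • ∑ k ∈ Finset.Icc 1 t, x k) - F y
      + inner ℝ μ (B ((t : ℝ)⁻¹ • ∑ k ∈ Finset.Icc 1 t, x k))
      ≤ 1 / (t : ℝ) * (1 / 2 * ‖C (y - x 0)‖ ^ 2 + 1 / 2 * ‖μ‖ ^ 2) := by
  have ht0 : (0 : ℝ) < t := by exact_mod_cast ht
  have hmem : ∀ k ∈ Finset.Icc 1 t, x k ∈ S := by
    intro k hk
    obtain ⟨m, rfl⟩ := Nat.exists_eq_add_of_le' (Finset.mem_Icc.1 hk).1
    exact h.mem m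
  have hsum : ∀ m : ℕ, 2 * (∑ k ∈ Finset.Icc 1 m, (F (x k) - F y + inner ℝ μ (B (x k))))
      + lyapunov B C x y μ m ≤ lyapunov B C x y μ 0 := by
    intro m
    induction m with
    | zero => simp
    | succ m ih =>
      have h1 := h.lyapunov_succ_le hy hBy μ m
      have h2 := hCBK (x (m + 1) - x m)
      have h3 := sq_nonneg ‖B (x (m + 1))‖
      rw [Finset.sum_Icc_succ_top (by omega)]
      linarith
  -- The dual variable starts at `0` because the partial sum is empty, whence the term `‖μ‖ ^ 2`.
  have hV0 : lyapunov B C x y μ 0 ≤ ‖C (y - x 0)‖ ^ 2 + ‖μ‖ ^ 2 := by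
    simp only [lyapunov, partialSum_zero, map_zero, zero_sub, norm_neg]
    linarith [sq_nonneg ‖B (x 0)‖]
  have hVt : 0 ≤ lyapunov B C x y μ t := by
    refine le_trans ?_ (sq_norm_le_lyapunov (ε := 0) (C := C) ?_ hBy μ t)
    · simp
    · intro d; nlinarith [hCBK d, sq_nonneg ‖K d‖]
  have hw : ∑ k ∈ Finset.Icc 1 t, (t : ℝ)⁻¹ = 1 := by
    simp [Finset.sum_const, ht0.ne']
  have hJ := hF.map_sum_le (t := Finset.Icc 1 t) (w := fun _ => (t : ℝ)⁻¹) (p := x)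
    (fun _ _ => by positivity) hw hmem
  have hS := hF.1.sum_mem (t := Finset.Icc 1 t) (w := fun _ => (t : ℝ)⁻¹) (z := x)
    (fun _ _ => by positivity) hw hmem
  rw [← Finset.smul_sum] at hJ hS
  refine ⟨hS, ?_⟩
  have hsplit : ∑ k ∈ Finset.Icc 1 t, (F (x k) - F y + inner ℝ μ (B (x k)))
      = ∑ k ∈ Finset.Icc 1 t, F (x k) - t * F y
        + inner ℝ μ (B (∑ k ∈ Finset.Icc 1 t, x k)) := by
    rw [Finset.sum_add_distrib, Finset.sum_sub_distrib, map_sum, inner_sum]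
    simp
  have h4 := hsum t
  rw [hsplit] at h4
  rw [map_smul, inner_smul_right]
  rw [← Finset.smul_sum, smul_eq_mul] at hJ
  have h5 : ∑ k ∈ Finset.Icc 1 t, F (x k) - t * F y
      + inner ℝ μ (B (∑ k ∈ Finset.Icc 1 t, x k))
      ≤ 1 / 2 * ‖C (y - x 0)‖ ^ 2 + 1 / 2 * ‖μ‖ ^ 2 := by linarith
  have h6 := mul_le_mul_of_nonneg_left h5 (inv_nonneg.2 ht0.le)
  have h7 : (t : ℝ)⁻¹ * (t * F y) = F y := by field_simp
  rw [one_div]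
  rw [mul_add, mul_sub, h7] at h6
  linarith

/-- `(y, μ)` is a saddle point: `y ∈ S` is feasible and minimizes `F + ⟨μ, B ·⟩` over `S`. -/
structure IsSaddle (B : X →ₗ[ℝ] E) (S : Set X) (F : X → ℝ) (y : X) (μ : E) : Prop where
  mem : y ∈ S
  feasible : B y = 0
  le : ∀ z ∈ S, F y ≤ F z + inner ℝ μ (B z)

lemma IsLinearizedStep.lyapunov_decrease (h : IsLinearizedStep B C K S F x) {y : X} {μ : E}
    (hs : IsSaddle B S F y μ) {ε : ℝ}
    (hCBK : ∀ d, ε * ‖d‖ ^ 2 + ‖B d‖ ^ 2 + ‖K d‖ ^ 2 ≤ ‖C d‖ ^ 2) (k : ℕ) :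
    ‖B (x (k + 1))‖ ^ 2 + ε * ‖x (k + 1) - x k‖ ^ 2 + lyapunov B C x y μ (k + 1)
      ≤ lyapunov B C x y μ k := by
  have h1 := h.lyapunov_succ_le hs.mem hs.feasible μ k
  have h2 := hs.le _ (h.mem k)
  have h3 := hCBK (x (k + 1) - x k)
  linarith

/-- An Opial-type argument: the primal-dual iterates are bounded, every cluster point of them is a
saddle point, and the distance-like function centred at a saddle point is monotone, so a single
cluster point attracts the whole sequence. -/
theorem IsLinearizedStep.exists_tendsto [FiniteDimensional ℝ X] [FiniteDimensional ℝ E]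
    (h : IsLinearizedStep B C K S F x) {ε : ℝ} (hε : 0 < ε)
    (hCBK : ∀ d, ε * ‖d‖ ^ 2 + ‖B d‖ ^ 2 + ‖K d‖ ^ 2 ≤ ‖C d‖ ^ 2)
    (hclosed : IsClosed {q : X × ℝ | q.1 ∈ S ∧ F q.1 ≤ q.2}) {y : X} {μ : E}
    (hs : IsSaddle B S F y μ) :
    ∃ xlim ∈ S, B xlim = 0 ∧ (∀ z ∈ S, B z = 0 → F xlim ≤ F z) ∧
      Tendsto x atTop (𝓝 xlim) := by
  have hB : Continuous B := B.continuous_of_finiteDimensional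
  have hC : Continuous C := C.continuous_of_finiteDimensional
  have hK : Continuous K := K.continuous_of_finiteDimensional
  have hCB : ∀ d, ε * ‖d‖ ^ 2 + ‖B d‖ ^ 2 ≤ ‖C d‖ ^ 2 := fun d => by
    linarith [hCBK d, sq_nonneg ‖K d‖]
  have hanti : ∀ {y : X} {μ : E}, IsSaddle B S F y μ → Antitone (lyapunov B C x y μ) := by
    intro y μ hs
    refine antitone_nat_of_succ_le fun k => ?_
    have := h.lyapunov_decrease hs hCBK k
    have h1 : 0 ≤ ε * ‖x (k + 1) - x k‖ ^ 2 := by positivity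
    linarith [sq_nonneg ‖B (x (k + 1))‖]
  have hnonneg : ∀ {y : X} {μ : E}, IsSaddle B S F y μ → ∀ k, 0 ≤ lyapunov B C x y μ k := by
    intro y μ hs k
    exact le_trans (by positivity) (sq_norm_le_lyapunov hCB hs.feasible μ k)
  set V := lyapunov B C x y μ with hV
  have hVlim : ∃ l, Tendsto V atTop (𝓝 l) :=
    ⟨_, tendsto_atTop_ciInf (hanti hs) ⟨0, by rintro _ ⟨k, rfl⟩; exact hnonneg hs k⟩⟩
  obtain ⟨l, hl⟩ := hVlim
  have hdiff : Tendsto (fun k => V k - V (k + 1)) atTop (𝓝 0) := by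
    simpa using hl.sub (hl.comp (tendsto_add_atTop_nat 1))
  have hBx : Tendsto (fun k => B (x (k + 1))) atTop (𝓝 0) := by
    rw [tendsto_zero_iff_norm_tendsto_zero]
    have : Tendsto (fun k => ‖B (x (k + 1))‖ ^ 2) atTop (𝓝 0) := by
      refine squeeze_zero (fun k => sq_nonneg _) (fun k => ?_) hdiff
      have := h.lyapunov_decrease hs hCBK k
      have h1 : 0 ≤ ε * ‖x (k + 1) - x k‖ ^ 2 := by positivity
      simp only [hV]; linarith
    simpa using this.sqrt
  have hΔ : Tendsto (fun k => x (k + 1) - x k) atTop (𝓝 0) := by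
    rw [tendsto_zero_iff_norm_tendsto_zero]
    have : Tendsto (fun k => ‖x (k + 1) - x k‖ ^ 2) atTop (𝓝 0) := by
      have h0 : Tendsto (fun k => ε⁻¹ * (V k - V (k + 1))) atTop (𝓝 0) := by
        simpa using hdiff.const_mul ε⁻¹
      refine squeeze_zero (fun k => sq_nonneg _) (fun k => ?_) h0
      have := h.lyapunov_decrease hs hCBK k
      rw [le_inv_mul_iff₀ hε]
      simp only [hV]; linarith [sq_nonneg ‖B (x (k + 1))‖]
    simpa using this.sqrt
  -- a convergent subsequence of the primal-dual iterates
  have hbound : ∀ k, (x k, B (partialSum x k)) ∈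
      Metric.closedBall y (Real.sqrt (V 0 / ε)) ×ˢ Metric.closedBall μ (Real.sqrt (V 0)) := by
    intro k
    have h1 := (sq_norm_le_lyapunov (x := x) hCB hs.feasible μ k).trans (hanti hs (Nat.zero_le k))
    constructor
    · rw [mem_closedBall_iff_norm, norm_sub_rev]
      refine Real.le_sqrt_of_sq_le ?_
      rw [le_div_iff₀ hε]
      linarith [sq_nonneg ‖B (partialSum x k) - μ‖]
    · rw [mem_closedBall_iff_norm]
      refine Real.le_sqrt_of_sq_le ?_
      have : 0 ≤ ε * ‖y - x k‖ ^ 2 := by positivity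
      linarith
  obtain ⟨⟨xl, μl⟩, -, φ, hφ, hlim⟩ :=
    ((isCompact_closedBall y _).prod (isCompact_closedBall μ _)).tendsto_subseq hbound
  have hx1 : Tendsto (fun j => x (φ j)) atTop (𝓝 xl) := (continuous_fst.tendsto _).comp hlim
  have hμ1 : Tendsto (fun j => B (partialSum x (φ j))) atTop (𝓝 μl) :=
    (continuous_snd.tendsto _).comp hlim
  have hΔφ := hΔ.comp hφ.tendsto_atTop
  have hx2 : Tendsto (fun j => x (φ j + 1)) atTop (𝓝 xl) := by
    have := hx1.add hΔφ
    simpa using this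
  have hBxl : B xl = 0 :=
    tendsto_nhds_unique ((hB.tendsto xl).comp hx2) (hBx.comp hφ.tendsto_atTop)
  -- `S` need not be closed nor `F` continuous. The step inequality is read as membership of a point
  -- in the epigraph, whose closedness gives `xl ∈ S` and the limiting inequality together.
  have key : ∀ z ∈ S, xl ∈ S ∧ F xl ≤ F z + inner ℝ μl (B z) := by
    intro z hz
    have hr : Tendsto (fun j => F z
        - inner ℝ (C (x (φ j) - x (φ j + 1))) (C (z - x (φ j + 1)))
        + inner ℝ (B (partialSum x (φ j)) + B (x (φ j))) (B (z - x (φ j + 1)))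
        + 1 / 2 * ‖K (x (φ j + 1) - x (φ j))‖ ^ 2) atTop
        (𝓝 (F z - inner ℝ (C (xl - xl)) (C (z - xl)) + inner ℝ (μl + B xl) (B (z - xl))
          + 1 / 2 * ‖K (xl - xl)‖ ^ 2)) := by
      have a1 := (hC.tendsto _).comp (hx1.sub hx2)
      have a2 := (hC.tendsto _).comp (hx2.const_sub z)
      have a3 := (hB.tendsto _).comp (hx2.const_sub z)
      have a4 := hμ1.add ((hB.tendsto _).comp hx1)
      have a5 := (hK.tendsto _).comp (hx2.sub hx1)
      exact ((tendsto_const_nhds.sub (a1.inner a2)).add (a4.inner a3)).add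
        ((a5.norm.pow 2).const_mul _)
    have hm := hclosed.mem_of_tendsto (hx2.prodMk_nhds hr) (Eventually.of_forall fun j =>
      ⟨h.mem _, by have := h.le (φ j) z hz; simp only; linarith⟩)
    simpa [hBxl] using hm
  have hsl : IsSaddle B S F xl μl := ⟨(key y hs.mem).1, hBxl, fun z hz => (key z hz).2⟩
  refine ⟨xl, hsl.mem, hBxl, fun z hz hBz => by simpa [hBz] using hsl.le z hz, ?_⟩
  -- The Lyapunov function is recentred at the cluster point: it vanishes along the subsequence and
  -- is antitone, hence vanishes along the full sequence.
  have hW : Tendsto (fun j => lyapunov B C x xl μl (φ j)) atTop (𝓝 0) := by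
    have a1 := (((hC.tendsto _).comp (hx1.const_sub xl)).norm.pow 2)
    have a2 := (((hB.tendsto _).comp hx1).norm.pow 2)
    have a3 := ((hμ1.sub_const μl).norm.pow 2)
    have a := (a1.sub a2).add a3
    have h0 : ‖C (xl - xl)‖ ^ 2 - ‖B xl‖ ^ 2 + ‖μl - μl‖ ^ 2 = 0 := by simp [hBxl]
    rw [h0] at a
    exact a
  have hW' : Tendsto (lyapunov B C x xl μl) atTop (𝓝 0) :=
    (tendsto_iff_tendsto_subseq_of_antitone (hanti hsl) hφ.tendsto_atTop).2 hW
  rw [tendsto_iff_norm_sub_tendsto_zero]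
  have hsq : Tendsto (fun k => ‖x k - xl‖ ^ 2) atTop (𝓝 0) := by
    have h0 : Tendsto (fun k => ε⁻¹ * lyapunov B C x xl μl k) atTop (𝓝 0) := by
      simpa using hW'.const_mul ε⁻¹
    refine squeeze_zero (fun k => sq_nonneg _) (fun k => ?_) h0
    have := sq_norm_le_lyapunov (x := x) hCB hBxl μl k
    rw [le_inv_mul_iff₀ hε, norm_sub_rev]
    linarith [sq_nonneg ‖B (partialSum x k) - μl‖]
  simpa using hsq.sqrt

end Abstract

/-! ### Lagrange multipliers and the subdifferential sum rule. -/

section Multiplier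

/-- The line through `z` and `y` stays in the affine span, where `z` is an interior point. Only this
algebraic form of relative interiority is used for multipliers: segments can be prolonged slightly
beyond `z`. -/
lemma eventually_mem_of_mem_intrinsicInterior {V : Type*} [NormedAddCommGroup V] [NormedSpace ℝ V]
    {D : Set V} {z y : V} (hz : z ∈ intrinsicInterior ℝ D) (hy : y ∈ D) :
    ∀ᶠ ε in 𝓝 (0 : ℝ), z - ε • (y - z) ∈ D := by
  obtain ⟨z', hz', rfl⟩ := hz
  have hmem : ∀ ε : ℝ, (z' : V) - ε • (y - z') ∈ affineSpan ℝ D := by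
    intro ε
    have h := AffineMap.lineMap_mem (-ε) z'.2 (subset_affineSpan ℝ D hy)
    rw [AffineMap.lineMap_apply_module'] at h
    convert h using 1
    rw [neg_smul]; abel
  have hcont : Continuous fun ε : ℝ => (⟨(z' : V) - ε • (y - z'), hmem ε⟩ : affineSpan ℝ D) := by
    fun_prop
  have h0 : (⟨(z' : V) - (0 : ℝ) • (y - z'), hmem 0⟩ : affineSpan ℝ D) = z' := by
    ext; simp
  have := hcont.tendsto 0
  rw [h0] at this
  filter_upwards [this (mem_interior_iff_mem_nhds.1 hz')] with ε hε using hε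

variable {X : Type*} [AddCommGroup X] [Module ℝ X] {S : Set X} {F : X → ℝ} {xs : X}

/-- The weighted barycentre of `x₁` and `x₂` works. This is what closes the cone over the epigraph,
with apex at `xs`, under addition. -/
lemma _root_.ConvexOn.exists_add_smul_sub (hF : ConvexOn ℝ S F) {x₁ x₂ : X} (h₁ : x₁ ∈ S)
    (h₂ : x₂ ∈ S) {t₁ t₂ : ℝ} (ht₁ : 0 ≤ t₁) (ht₂ : 0 ≤ t₂) :
    ∃ x ∈ S, t₁ • (x₁ - xs) + t₂ • (x₂ - xs) = (t₁ + t₂) • (x - xs) ∧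
      (t₁ + t₂) * (F x - F xs) ≤ t₁ * (F x₁ - F xs) + t₂ * (F x₂ - F xs) := by
  rcases (add_nonneg ht₁ ht₂).eq_or_lt with h | h
  · obtain rfl : t₁ = 0 := by linarith
    obtain rfl : t₂ = 0 := by linarith
    exact ⟨x₁, h₁, by simp, by simp⟩
  · have ha : 0 ≤ t₁ / (t₁ + t₂) := by positivity
    have hb : 0 ≤ t₂ / (t₁ + t₂) := by positivity
    have hab : t₁ / (t₁ + t₂) + t₂ / (t₁ + t₂) = 1 := by field_simp
    refine ⟨_, hF.1 h₁ h₂ ha hb hab, ?_, ?_⟩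
    · have e1 : (t₁ + t₂) * (t₁ / (t₁ + t₂)) = t₁ := by field_simp
      have e2 : (t₁ + t₂) * (t₂ / (t₁ + t₂)) = t₂ := by field_simp
      rw [smul_sub (t₁ + t₂), smul_add, smul_smul, smul_smul, e1, e2]
      module
    · have h3 := mul_le_mul_of_nonneg_left (hF.2 h₁ h₂ ha hb hab) h.le
      have e : (t₁ + t₂) * (t₁ / (t₁ + t₂) * F x₁ + t₂ / (t₁ + t₂) * F x₂)
          = t₁ * F x₁ + t₂ * F x₂ := by field_simp
      simp only [smul_eq_mul] at h3 ⊢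
      rw [e] at h3
      linarith

/-- A Lagrange multiplier for minimizing a convex function over `S ∩ A`, `A` a subspace that meets
the algebraic relative interior of `S`. -/
theorem _root_.ConvexOn.exists_multiplier (hF : ConvexOn ℝ S F) (A : Submodule ℝ X) (hxs : xs ∈ S)
    (hxsA : xs ∈ A) (hmin : ∀ z ∈ S, z ∈ A → F xs ≤ F z) {z₀ : X} (hz₀A : z₀ ∈ A)
    (hz₀ : ∀ y ∈ S, ∃ ε : ℝ, 0 < ε ∧ z₀ - ε • (y - z₀) ∈ S) :
    ∃ g : X →ₗ[ℝ] ℝ, (∀ a ∈ A, g a = 0) ∧ ∀ y ∈ S, F xs + g (y - xs) ≤ F y := by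
  -- The cone generated by the epigraph of `F` translated to `(xs, F xs)`, enlarged by `A`. A
  -- functional nonnegative on it and equal to `r` on `(0, r)` is a supporting hyperplane that
  -- ignores `A`.
  let s : PointedCone ℝ (X × ℝ) :=
    { carrier := {q | ∃ t : ℝ, 0 ≤ t ∧ ∃ x ∈ S, ∃ a ∈ A, q.1 = t • (x - xs) + a ∧
        t * (F x - F xs) ≤ q.2}
      zero_mem' := ⟨0, le_rfl, xs, hxs, 0, A.zero_mem, by simp, by simp⟩
      add_mem' := by
        rintro ⟨w₁, r₁⟩ ⟨w₂, r₂⟩ ⟨t₁, ht₁, x₁, hx₁, a₁, ha₁, rfl, hr₁⟩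
          ⟨t₂, ht₂, x₂, hx₂, a₂, ha₂, rfl, hr₂⟩
        obtain ⟨x, hx, he, hle⟩ := hF.exists_add_smul_sub (xs := xs) hx₁ hx₂ ht₁ ht₂
        refine ⟨t₁ + t₂, add_nonneg ht₁ ht₂, x, hx, a₁ + a₂, A.add_mem ha₁ ha₂, ?_, ?_⟩
        · simp only [Prod.mk_add_mk, ← he]; abel
        · simp only [Prod.mk_add_mk] at *; linarith
      smul_mem' := by
        rintro ⟨c, hc⟩ ⟨w, r⟩ ⟨t, ht, x, hx, a, ha, rfl, hr⟩
        refine ⟨c * t, mul_nonneg hc ht, x, hx, c • a, A.smul_mem c ha, ?_, ?_⟩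
        · change c • (t • (x - xs) + a) = _
          rw [smul_add, smul_smul]
        · change _ ≤ c * r
          have := mul_le_mul_of_nonneg_left hr hc
          simp only at this
          linarith }
  -- The projection of the cone to `X`. It is a subspace because, modulo `A`, the prolongation of
  -- the segment from `x` through `z₀` supplies the direction opposite to `x - xs`.
  let W : Submodule ℝ X :=
    { carrier := {w | ∃ t : ℝ, 0 ≤ t ∧ ∃ x ∈ S, ∃ a ∈ A, w = t • (x - xs) + a}
      zero_mem' := ⟨0, le_rfl, xs, hxs, 0, A.zero_mem, by simp⟩
      add_mem' := by
        rintro _ _ ⟨t₁, ht₁, x₁, hx₁, a₁, ha₁, rfl⟩ ⟨t₂, ht₂, x₂, hx₂, a₂, ha₂, rfl⟩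
        obtain ⟨x, hx, he, -⟩ := hF.exists_add_smul_sub (xs := xs) hx₁ hx₂ ht₁ ht₂
        exact ⟨t₁ + t₂, add_nonneg ht₁ ht₂, x, hx, a₁ + a₂, A.add_mem ha₁ ha₂, by
          rw [← he]; abel⟩
      smul_mem' := by
        rintro c _ ⟨t, ht, x, hx, a, ha, rfl⟩
        rcases le_total 0 c with hc | hc
        · exact ⟨c * t, mul_nonneg hc ht, x, hx, c • a, A.smul_mem c ha, by
            rw [smul_add, smul_smul]⟩
        · obtain ⟨ε, hε, hx'⟩ := hz₀ x hx
          refine ⟨-c * t / ε, div_nonneg (mul_nonneg (neg_nonneg.2 hc) ht) hε.le, _, hx',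
            c • a - (-c * t / ε * (1 + ε)) • (z₀ - xs),
            A.sub_mem (A.smul_mem _ ha) (A.smul_mem _ (A.sub_mem hz₀A hxsA)), ?_⟩
          have e : z₀ - ε • (x - z₀) - xs = (1 + ε) • (z₀ - xs) - ε • (x - xs) := by module
          have e2 : -c * t / ε * ε = -c * t := by field_simp
          rw [e]
          linear_combination (norm := module) e2 • (x - xs) }
  have hAW : A ≤ W := fun a ha => ⟨0, le_rfl, xs, hxs, a, ha, by simp⟩
  obtain ⟨W', hW'⟩ := W.exists_isCompl
  -- The complement `W'` is included so that the domain of `f` plus the cone is all of `X × ℝ`, as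
  -- the extension theorem requires. It adds nothing to positivity, since `W ∩ (A ⊔ W') = A`, and
  -- there nonnegativity is the minimality of `xs`.
  let f : X × ℝ →ₗ.[ℝ] ℝ :=
    ⟨(A ⊔ W').prod ⊤, (LinearMap.snd ℝ X ℝ).comp ((A ⊔ W').prod ⊤).subtype⟩
  obtain ⟨g, hg, hgs⟩ := riesz_extension s f (by
    rintro ⟨⟨w, r⟩, hw, _⟩ ⟨t, ht, x, hx, a, ha, hwe, hr⟩
    change 0 ≤ r
    change w ∈ A ⊔ W' at hw
    simp only at hwe hr
    obtain ⟨a₁, ha₁, w', hw', hsum⟩ := Submodule.mem_sup.1 hw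
    have hw'W : w' ∈ W := by
      have : w' = (t • (x - xs) + a) - a₁ := by rw [← hwe, ← hsum]; abel
      rw [this]
      exact W.sub_mem ⟨t, ht, x, hx, a, ha, rfl⟩ (hAW ha₁)
    have hw0 : w' = 0 := Submodule.disjoint_def.1 hW'.disjoint w' hw'W hw'
    refine le_trans ?_ hr
    rcases ht.eq_or_lt with rfl | ht
    · simp
    refine mul_nonneg ht.le (sub_nonneg.2 (hmin x hx ?_))
    have h1 : t • (x - xs) ∈ A := by
      have : t • (x - xs) = a₁ - a := by
        rw [hw0, add_zero] at hsum; rw [hsum, hwe]; abel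
      rw [this]; exact A.sub_mem ha₁ ha
    have h2 := (A.smul_mem_iff ht.ne').1 h1
    simpa using A.add_mem h2 hxsA) (by
    rintro ⟨w, ρ⟩
    obtain ⟨w₁, ⟨t, ht, x, hx, a, ha, rfl⟩, w₂, hw₂, rfl⟩ :=
      Submodule.mem_sup.1 (hW'.sup_eq_top ▸ Submodule.mem_top : w ∈ W ⊔ W')
    refine ⟨⟨(-w₂, t * (F x - F xs) - ρ), Submodule.neg_mem _ (Submodule.mem_sup_right hw₂),
      trivial⟩, t, ht, x, hx, a, ha, ?_, ?_⟩
    · simp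
    · simp)
  have hgA : ∀ a ∈ A, g (a, 0) = 0 := fun a ha =>
    hg ⟨(a, 0), Submodule.mem_sup_left ha, trivial⟩
  have hg1 : ∀ r : ℝ, g (0, r) = r := fun r => hg ⟨(0, r), Submodule.zero_mem _, trivial⟩
  refine ⟨-(g.comp (LinearMap.inl ℝ X ℝ)), fun a ha => by simp [hgA a ha], fun y hy => ?_⟩
  have h1 : 0 ≤ g (y - xs, F y - F xs) :=
    hgs _ ⟨1, zero_le_one, y, hy, 0, A.zero_mem, by simp, by simp⟩
  have h2 : g (y - xs, F y - F xs) = g (y - xs, 0) + (F y - F xs) := by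
    conv_rhs => rw [← hg1 (F y - F xs), ← map_add]
    simp
  simp only [LinearMap.neg_apply, LinearMap.comp_apply, LinearMap.inl_apply]
  linarith

/-- The sum rule for subdifferentials, at a minimizer of a sum of convex functions whose domains
have a common relative interior point. -/
theorem exists_subgradients_sum_eq_zero {ι V : Type*} [Fintype ι] [DecidableEq ι]
    [NormedAddCommGroup V] [InnerProductSpace ℝ V] [FiniteDimensional ℝ V] {D : ι → Set V}
    {φ : ι → V → ℝ} (hφ : ∀ i, ConvexOn ℝ (D i) (φ i)) {xs : V} (hxs : ∀ i, xs ∈ D i)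
    (hmin : ∀ y, (∀ i, y ∈ D i) → ∑ i, φ i xs ≤ ∑ i, φ i y)
    (hri : (⋂ i, intrinsicInterior ℝ (D i)).Nonempty) :
    -- The multiplier theorem is applied on the product space with `A` the diagonal. Vanishing on
    -- the diagonal says that the components of the multiplier sum to zero; changing one coordinate
    -- at a time separates the subgradient inequalities.
    ∃ q : ι → V, ∑ i, q i = 0 ∧ ∀ i, ∀ y ∈ D i, φ i xs + inner ℝ (q i) (y - xs) ≤ φ i y := by
  obtain ⟨z, hz⟩ := hri
  rw [Set.mem_iInter] at hz
  have hconv : ConvexOn ℝ {x : ι → V | ∀ i, x i ∈ D i} (fun x => ∑ i, φ i (x i)) := by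
    refine ⟨fun x hx y hy a b ha hb hab i => (hφ i).1 (hx i) (hy i) ha hb hab,
      fun x hx y hy a b ha hb hab => ?_⟩
    simp only [smul_eq_mul, Finset.mul_sum, ← Finset.sum_add_distrib]
    exact Finset.sum_le_sum fun i _ => (hφ i).2 (hx i) (hy i) ha hb hab
  let diag : V →ₗ[ℝ] (ι → V) := LinearMap.pi fun _ => LinearMap.id
  obtain ⟨g, hgA, hg⟩ := hconv.exists_multiplier (LinearMap.range diag)
    (xs := fun _ => xs) (z₀ := fun _ => z) hxs ⟨xs, rfl⟩
    (by rintro _ hz ⟨y, rfl⟩; exact hmin y hz) ⟨z, rfl⟩ (by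
      intro y hy
      have h1 : ∀ᶠ ε in 𝓝[>] (0 : ℝ), ∀ i, z - ε • (y i - z) ∈ D i := by
        rw [eventually_all]
        exact fun i => (eventually_mem_of_mem_intrinsicInterior (hz i) (hy i)).filter_mono
          nhdsWithin_le_nhds
      obtain ⟨ε, hε, hε0⟩ := (h1.and self_mem_nhdsWithin).exists
      exact ⟨ε, hε0, hε⟩)
  let q : ι → V := fun i => (InnerProductSpace.toDual ℝ V).symm
    (LinearMap.toContinuousLinearMap (g.comp (LinearMap.single ℝ (fun _ => V) i)))
  have hq : ∀ i v, inner ℝ (q i) v = g (Pi.single i v) := by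
    intro i v
    simp [q]
  refine ⟨q, ?_, fun i y hy => ?_⟩
  · refine ext_inner_right ℝ fun v => ?_
    rw [sum_inner, inner_zero_left]
    simp only [hq]
    rw [← map_sum]
    refine Eq.trans ?_ (hgA (diag v) ⟨v, rfl⟩)
    congr 1
    exact Finset.univ_sum_single (diag v)
  · have h := hg (Function.update (fun _ => xs) i y) (fun j => by
      rcases eq_or_ne j i with rfl | hj
      · simpa using hy
      · simpa [hj] using hxs j)
    have e1 : Function.update (fun _ => xs) i y - (fun _ => xs) = Pi.single i (y - xs) := by
      ext j : 1
      rcases eq_or_ne j i with rfl | hj <;> simp [*]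
    rw [e1, ← hq, ← Finset.add_sum_erase _ _ (Finset.mem_univ i),
      ← Finset.add_sum_erase (a := i) Finset.univ 
        (fun j => φ j (Function.update (fun _ => xs) i y j))
        (Finset.mem_univ i)] at h
    have e2 : ∑ j ∈ Finset.univ.erase i, φ j (Function.update (fun _ => xs) i y j)
        = ∑ j ∈ Finset.univ.erase i, φ j xs :=
      Finset.sum_congr rfl fun j hj => by simp [Finset.ne_of_mem_erase hj]
    rw [e2] at h
    simp only [Function.update_self] at h
    linarith

end Multiplier

/-! ### First-order bounds for the smooth part. -/

section Smooth

variable {V : Type*} [NormedAddCommGroup V] [InnerProductSpace ℝ V] [CompleteSpace V]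
  {f : V → ℝ} {x y : V}

lemma hasDerivAt_comp_segment {t : ℝ} (hf : DifferentiableAt ℝ f (x + t • (y - x))) :
    HasDerivAt (fun τ : ℝ => f (x + τ • (y - x)))
      (inner ℝ (gradient f (x + t • (y - x))) (y - x)) t := by
  have h1 := hf.hasGradientAt.hasFDerivAt
  have h2 : HasDerivAt (fun τ : ℝ => x + τ • (y - x)) (y - x) t := by
    simpa using ((hasDerivAt_id t).smul_const (y - x)).const_add x
  exact h1.comp_hasDerivAt t h2

/-- Restriction to the line through `x` and `y` reduces this to the slope inequality in one
variable; differentiability is needed only at `x`, so `y` may lie outside `U`. -/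
lemma _root_.ConvexOn.add_inner_gradient_le (hf : ConvexOn ℝ Set.univ f)
    (hx : DifferentiableAt ℝ f x) (y : V) : f x + inner ℝ (gradient f x) (y - x) ≤ f y := by
  have hd := hasDerivAt_comp_segment (f := f) (x := x) (y := y) (t := 0) (by simpa using hx)
  have hc : ConvexOn ℝ Set.univ (fun τ : ℝ => f (x + τ • (y - x))) := by
    have := hf.comp_affineMap (AffineMap.lineMap x y : ℝ →ᵃ[ℝ] V)
    refine this.congr fun τ _ => ?_
    simp [AffineMap.lineMap_apply_module', add_comm]
  have := hc.le_slope_of_hasDerivAt (Set.mem_univ 0) (Set.mem_univ 1) zero_lt_one hd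
  simp [slope_def_field, -inner_gradient_left] at this
  linarith

/-- The descent lemma, along a segment in a set on which the gradient is Lipschitz. -/
lemma le_add_inner_gradient_add_sq {U : Set V} {L : ℝ≥0} (hd : ∀ z ∈ U, DifferentiableAt ℝ f z)
    (hL : LipschitzOnWith L (gradient f) U) (hseg : segment ℝ x y ⊆ U) :
    f y ≤ f x + inner ℝ (gradient f x) (y - x) + L / 2 * ‖y - x‖ ^ 2 := by
  have hmem : ∀ t ∈ Set.Icc (0 : ℝ) 1, x + t • (y - x) ∈ U := fun t ht => hseg (by
    rw [segment_eq_image']; exact ⟨t, ht, rfl⟩)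
  -- The quadratic correction is chosen so that the Lipschitz bound makes the derivative
  -- nonpositive; the claim is then `g 1 ≤ g 0`.
  set g : ℝ → ℝ := fun t => f (x + t • (y - x)) - t * inner ℝ (gradient f x) (y - x)
    - t ^ 2 * (L / 2 * ‖y - x‖ ^ 2) with hg
  have hderiv : ∀ t ∈ Set.Icc (0 : ℝ) 1, HasDerivAt g
      (inner ℝ (gradient f (x + t • (y - x))) (y - x) - inner ℝ (gradient f x) (y - x)
        - 2 * t * (L / 2 * ‖y - x‖ ^ 2)) t := by
    intro t ht
    have h1 := hasDerivAt_comp_segment (hd _ (hmem t ht))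
    have h2 := (hasDerivAt_id t).mul_const (inner ℝ (gradient f x) (y - x))
    have h3 := (hasDerivAt_pow 2 t).mul_const (L / 2 * ‖y - x‖ ^ 2)
    convert! (h1.sub h2).sub h3 using 1
    simp [-inner_gradient_left]
  have hanti : AntitoneOn g (Set.Icc 0 1) := by
    refine antitoneOn_of_hasDerivWithinAt_nonpos (convex_Icc 0 1)
      (fun t ht => (hderiv t ht).continuousAt.continuousWithinAt)
      (fun t ht => (hderiv t (interior_subset ht)).hasDerivWithinAt) fun t ht => ?_
    have ht' : t ∈ Set.Icc (0 : ℝ) 1 := interior_subset ht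
    rw [← inner_sub_left]
    have h1 := real_inner_le_norm (gradient f (x + t • (y - x)) - gradient f x) (y - x)
    have h2 := hL.norm_sub_le (hmem t ht') (hseg (left_mem_segment ℝ x y))
    rw [add_sub_cancel_left, norm_smul, Real.norm_of_nonneg ht'.1] at h2
    have h3 := mul_le_mul_of_nonneg_right h2 (norm_nonneg (y - x))
    nlinarith
  have := hanti (Set.left_mem_Icc.2 zero_le_one) (Set.right_mem_Icc.2 zero_le_one) zero_le_one
  simp [hg, -inner_gradient_left] at this
  linarith

end Smooth

lemma nonneg_of_forall_add_mul_nonneg {a b : ℝ}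
    (h : ∀ t : ℝ, 0 < t → t ≤ 1 → 0 ≤ a + t * b) : 0 ≤ a := by
  have h1 : Tendsto (fun t : ℝ => a + t * b) (𝓝[>] 0) (𝓝 (a + 0 * b)) :=
    ((by fun_prop : Continuous fun t : ℝ => a + t * b).tendsto 0).mono_left nhdsWithin_le_nhds
  rw [zero_mul, add_zero] at h1
  refine ge_of_tendsto h1 ?_
  filter_upwards [Ioc_mem_nhdsGT (zero_lt_one' ℝ)] with t ht using h t ht.1 ht.2

lemma coe_sum {ι : Type*} (s : Finset ι) (g : ι → ℝ) :
    ((∑ i ∈ s, g i : ℝ) : EReal) = ∑ i ∈ s, (g i : EReal) := by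
  classical
  induction s using Finset.induction_on with
  | empty => simp
  | insert a s ha ih => rw [Finset.sum_insert ha, Finset.sum_insert ha, EReal.coe_add, ih]

lemma ne_bot_sum {ι : Type*} {s : Finset ι} {g : ι → EReal} (hg : ∀ i ∈ s, g i ≠ ⊥) :
    ∑ i ∈ s, g i ≠ ⊥ := by
  classical
  induction s using Finset.induction_on with
  | empty => simp
  | insert a s ha ih =>
    rw [Finset.sum_insert ha, Ne, EReal.add_eq_bot_iff, not_or]
    exact ⟨hg a (by simp), ih fun i hi => hg i (by simp [hi])⟩

lemma ne_top_of_sum_ne_top {ι : Type*} [Fintype ι] {g : ι → EReal} (hg : ∀ i, g i ≠ ⊥)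
    (h : ∑ i, g i ≠ ⊤) (i : ι) : g i ≠ ⊤ := by
  classical
  intro hi
  apply h
  rw [← Finset.add_sum_erase _ _ (Finset.mem_univ i), hi]
  exact EReal.top_add_of_ne_bot (ne_bot_sum fun j _ => hg j)

/-! ### Extended-valued convex functions and the proximal gradient step. -/

section Extended

variable {n : ℕ} {ξ : Vec n → EReal} {f : Vec n → ℝ}

lemma IsClosedConvex.coe_toReal (h : IsClosedConvex ξ) {x : Vec n} (hx : x ∈ effDom ξ) :
    ((ξ x).toReal : EReal) = ξ x := EReal.coe_toReal hx (h.ne_bot x)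

lemma IsClosedConvex.convexOn (h : IsClosedConvex ξ) :
    ConvexOn ℝ (effDom ξ) fun x => (ξ x).toReal := by
  have key : ∀ x ∈ effDom ξ, ∀ y ∈ effDom ξ, ∀ a b : ℝ, 0 ≤ a → 0 ≤ b → a + b = 1 →
      ξ (a • x + b • y) ≤ ((a * (ξ x).toReal + b * (ξ y).toReal : ℝ) : EReal) := by
    intro x hx y hy a b ha hb hab
    exact h.convex (x := (x, (ξ x).toReal)) (by simp [epigraph, h.coe_toReal hx])
      (y := (y, (ξ y).toReal)) (by simp [epigraph, h.coe_toReal hy]) ha hb hab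
  have hconv : Convex ℝ (effDom ξ) := fun x hx y hy a b ha hb hab =>
    ((key x hx y hy a b ha hb hab).trans_lt (EReal.coe_lt_top _)).ne
  refine ⟨hconv, fun x hx y hy a b ha hb hab => ?_⟩
  have h1 := key x hx y hy a b ha hb hab
  rw [← h.coe_toReal (hconv hx hy ha hb hab)] at h1
  exact EReal.coe_le_coe_iff.1 h1

lemma IsClosedConvex.composite_ne_bot (h : IsClosedConvex ξ) (x : Vec n) :
    composite ξ f x ≠ ⊥ := by
  rw [composite, Ne, EReal.add_eq_bot_iff, not_or]
  exact ⟨h.ne_bot x, EReal.coe_ne_bot _⟩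

lemma composite_ne_top_iff {x : Vec n} : composite ξ f x ≠ ⊤ ↔ x ∈ effDom ξ := by
  refine ⟨fun h hx => h ?_, fun h => ?_⟩
  · rw [composite, hx, EReal.top_add_coe]
  · exact EReal.add_ne_top h (EReal.coe_ne_top _)

/-- The real values of `Φ = ξ + f`, meaningful on the domain of `ξ`. -/
def realComposite (ξ : Vec n → EReal) (f : Vec n → ℝ) (x : Vec n) : ℝ := (ξ x).toReal + f x

lemma IsClosedConvex.coe_realComposite (h : IsClosedConvex ξ) {x : Vec n} (hx : x ∈ effDom ξ) :
    (realComposite ξ f x : EReal) = composite ξ f x := by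
  rw [realComposite, composite, EReal.coe_add, h.coe_toReal hx]

lemma IsClosedConvex.mem_subdifferential (h : IsClosedConvex ξ) {x q : Vec n}
    (hx : x ∈ effDom ξ)
    (hq : ∀ y ∈ effDom ξ, realComposite ξ f x + inner ℝ q (y - x) ≤ realComposite ξ f y) :
    q ∈ subdifferential (composite ξ f) x := by
  intro y
  by_cases hy : y ∈ effDom ξ
  · rw [← h.coe_realComposite hx, ← h.coe_realComposite hy, ← EReal.coe_add]
    exact EReal.coe_le_coe_iff.2 (hq y hy)
  · rw [not_not.1 (mt composite_ne_top_iff.1 hy)]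
    exact le_top

/-- The domain of a proximal map, and the variational inequality that characterizes it. -/
lemma IsProx.mem_and_le {c : ℝ} (hc : 0 < c) (h : IsClosedConvex ξ) (hne : (effDom ξ).Nonempty)
    {v z : Vec n} (hz : IsProx c ξ v z) :
    z ∈ effDom ξ ∧ ∀ y ∈ effDom ξ,
      c * (ξ z).toReal + inner ℝ (v - z) (y - z) ≤ c * (ξ y).toReal := by
  have hzD : z ∈ effDom ξ := by
    obtain ⟨y, hy⟩ := hne
    intro hzt
    have h1 := hz y
    rw [hzt, EReal.coe_mul_top_of_pos hc, EReal.top_add_coe, ← h.coe_toReal hy, ← EReal.coe_mul,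
      ← EReal.coe_add, top_le_iff] at h1
    exact EReal.coe_ne_top _ h1
  refine ⟨hzD, fun y hy => ?_⟩
  have hmin : ∀ w ∈ effDom ξ, c * (ξ z).toReal + 1 / 2 * ‖z - v‖ ^ 2
      ≤ c * (ξ w).toReal + 1 / 2 * ‖w - v‖ ^ 2 := by
    intro w hw
    have h1 := hz w
    rw [← h.coe_toReal hw, ← h.coe_toReal hzD] at h1
    exact_mod_cast h1
  -- Minimality is tested at `(1 - t) • z + t • y`. After division by `t` the quadratic remainder is
  -- `t * (1 / 2 * ‖y - z‖ ^ 2)`, which disappears as `t → 0`.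
  have h0 := nonneg_of_forall_add_mul_nonneg
    (a := c * (ξ y).toReal - c * (ξ z).toReal - inner ℝ (v - z) (y - z))
    (b := 1 / 2 * ‖y - z‖ ^ 2) fun t ht0 ht1 => by
      have h1 := hmin _ (h.convexOn.1 hzD hy (sub_nonneg.2 ht1) ht0.le (by ring))
      have h2 := h.convexOn.2 hzD hy (sub_nonneg.2 ht1) ht0.le (by ring)
      have h3 : (1 - t) • z + t • y - v = t • (y - z) - (v - z) := by module
      rw [h3, norm_sub_sq_real (t • (y - z)), norm_smul, inner_smul_left, Real.norm_of_nonneg ht0.le,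
        norm_sub_rev z v, real_inner_comm] at h1
      simp only [smul_eq_mul, conj_trivial] at h1 h2
      have h4 := mul_le_mul_of_nonneg_left h2 hc.le
      refine nonneg_of_mul_nonneg_right (a := t) ?_ ht0
      nlinarith
  linarith

variable {U : Set (Vec n)} {L : ℝ≥0}

lemma IsCompositePair.convexOn (h : IsCompositePair ξ f U L) :
    ConvexOn ℝ (effDom ξ) (realComposite ξ f) :=
  h.nonsmooth.convexOn.add (h.smooth_convex.subset (Set.subset_univ _) h.nonsmooth.convexOn.1)

lemma IsCompositePair.lowerSemicontinuous (h : IsCompositePair ξ f U L) :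
    LowerSemicontinuous (composite ξ f) := by
  have hf : Continuous f := h.smooth_convex.locallyLipschitz.continuous
  refine h.nonsmooth.closed.add' (continuous_coe_real_ereal.comp hf).lowerSemicontinuous
    fun x => ?_
  exact EReal.continuousAt_add (Or.inr (EReal.coe_ne_bot _)) (Or.inr (EReal.coe_ne_top _))

/-- The inequality satisfied by one proximal gradient step. -/
lemma IsCompositePair.prox_step (h : IsCompositePair ξ f U L) (hne : (effDom ξ).Nonempty)
    {c : ℝ} (hc : 0 < c) {a z w : Vec n} (ha : ∀ y ∈ effDom ξ, segment ℝ a y ⊆ U)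
    (hz : IsProx c ξ (a - c • (gradient f a + w)) z) :
    z ∈ effDom ξ ∧ ∀ y ∈ effDom ξ, realComposite ξ f z + 1 / c * inner ℝ (a - z) (y - z)
      - inner ℝ w (y - z) - L / 2 * ‖z - a‖ ^ 2 ≤ realComposite ξ f y := by
  obtain ⟨hzD, hle⟩ := hz.mem_and_le hc h.nonsmooth hne
  refine ⟨hzD, fun y hy => ?_⟩
  -- The prox inequality involves the linearization of `f` at `a`: convexity bounds it by `f y` from
  -- above at `y`, and the descent lemma compares it with `f z` at `z`, at the cost `L / 2 * ‖z - a‖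
  -- ^ 2`.
  have h1 := hle y hy
  have haU : a ∈ U := ha z hzD (left_mem_segment ℝ a z)
  have h2 := h.smooth_convex.add_inner_gradient_le (h.differentiable a haU) y
  have h3 := le_add_inner_gradient_add_sq h.differentiable h.lipschitz (ha z hzD)
  have e1 : inner ℝ (a - c • (gradient f a + w) - z) (y - z) = inner ℝ (a - z) (y - z)
      - c * inner ℝ (gradient f a) (y - z) - c * inner ℝ w (y - z) := by
    rw [show a - c • (gradient f a + w) - z = (a - z) - c • (gradient f a + w) by abel,
      inner_sub_left, inner_smul_left, inner_add_left]
    simp only [conj_trivial]; ring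
  have e2 : inner ℝ (gradient f a) (y - a) - inner ℝ (gradient f a) (z - a)
      = inner ℝ (gradient f a) (y - z) := by
    rw [← inner_sub_right]; congr 1; abel
  rw [e1] at h1
  have h4 := mul_le_mul_of_nonneg_left h1 (one_div_pos.2 hc).le
  have e3 : 1 / c * (c * (ξ z).toReal + (inner ℝ (a - z) (y - z)
      - c * inner ℝ (gradient f a) (y - z) - c * inner ℝ w (y - z)))
      = (ξ z).toReal + 1 / c * inner ℝ (a - z) (y - z)
      - inner ℝ (gradient f a) (y - z) - inner ℝ w (y - z) := by
    field_simp; ring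
  have e4 : 1 / c * (c * (ξ y).toReal) = (ξ y).toReal := by field_simp
  rw [e3, e4] at h4
  simp only [realComposite]
  linarith

end Extended

/-! ### The separable objective as a real function on the product of the domains. -/

section Objective

variable {N n : ℕ} {ξ : Fin N → Vec n → EReal} {f : Fin N → Vec n → ℝ}

/-- The real values of the separable objective, meaningful where every `ξᵢ` is finite. -/
def realObjective (ξ : Fin N → Vec n → EReal) (f : Fin N → Vec n → ℝ) (x : Fin N → Vec n) : ℝ :=
  ∑ i, realComposite (ξ i) (f i) (x i)

/-- The product of the domains of the `ξᵢ`. -/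
def prodDom (ξ : Fin N → Vec n → EReal) : Set (Fin N → Vec n) := {x | ∀ i, x i ∈ effDom (ξ i)}

lemma coe_realObjective (h : ∀ i, IsClosedConvex (ξ i)) {x : Fin N → Vec n} (hx : x ∈ prodDom ξ) :
    (realObjective ξ f x : EReal) = objective ξ f x := by
  rw [objective, realObjective, coe_sum]
  exact Finset.sum_congr rfl fun i _ => (h i).coe_realComposite (hx i)

lemma objective_ne_top_iff (h : ∀ i, IsClosedConvex (ξ i)) {x : Fin N → Vec n} :
    objective ξ f x ≠ ⊤ ↔ x ∈ prodDom ξ := by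
  refine ⟨fun hx i => composite_ne_top_iff.1
    (ne_top_of_sum_ne_top (fun i => (h i).composite_ne_bot (x i)) hx i), fun hx => ?_⟩
  rw [← coe_realObjective h hx]
  exact EReal.coe_ne_top _

variable {U : Fin N → Set (Vec n)} {L : Fin N → ℝ≥0}

lemma convexOn_realObjective (h : ∀ i, IsCompositePair (ξ i) (f i) (U i) (L i)) :
    ConvexOn ℝ (prodDom ξ) (realObjective ξ f) := by
  refine ⟨fun x hx y hy a b ha hb hab i => (h i).convexOn.1 (hx i) (hy i) ha hb hab,
    fun x hx y hy a b ha hb hab => ?_⟩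
  simp only [realObjective, smul_eq_mul, Finset.mul_sum, ← Finset.sum_add_distrib]
  exact Finset.sum_le_sum fun i _ => (h i).convexOn.2 (hx i) (hy i) ha hb hab

lemma lowerSemicontinuous_objective (h : ∀ i, IsCompositePair (ξ i) (f i) (U i) (L i)) :
    LowerSemicontinuous (objective ξ f) := by
  have key : ∀ s : Finset (Fin N), LowerSemicontinuous
      fun x : Fin N → Vec n => ∑ i ∈ s, composite (ξ i) (f i) (x i) := by
    intro s
    induction s using Finset.induction_on with
    | empty => simpa using lowerSemicontinuous_const
    | insert a s ha ih =>
      simp only [Finset.sum_insert ha]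
      refine ((h a).lowerSemicontinuous.comp (continuous_apply a)).add' ih fun x => ?_
      exact EReal.continuousAt_add (Or.inr (ne_bot_sum fun i _ =>
        (h i).nonsmooth.composite_ne_bot _)) (Or.inl ((h a).nonsmooth.composite_ne_bot _))
  exact key Finset.univ

/-- Lower semicontinuity of the extended-valued objective, transported to its real version. This is
the closedness needed for limits of iterates, as the domain itself may fail to be closed. -/
lemma isClosed_epigraph_realObjective (h : ∀ i, IsCompositePair (ξ i) (f i) (U i) (L i)) :
    IsClosed {q : (Fin N → Vec n) × ℝ | q.1 ∈ prodDom ξ ∧ realObjective ξ f q.1 ≤ q.2} := by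
  have h0 : ∀ i, IsClosedConvex (ξ i) := fun i => (h i).nonsmooth
  have hc := (lowerSemicontinuous_objective h).isClosed_epigraph
  have hcont : Continuous fun q : (Fin N → Vec n) × ℝ => (q.1, (q.2 : EReal)) :=
    continuous_fst.prodMk (continuous_coe_real_ereal.comp continuous_snd)
  convert hc.preimage hcont using 1
  ext ⟨x, r⟩
  simp only [Set.mem_ofPred_eq, Set.mem_preimage]
  refine ⟨fun ⟨hx, hr⟩ => ?_, fun hr => ?_⟩
  · rw [← coe_realObjective h0 hx]
    exact EReal.coe_le_coe_iff.2 hr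
  · have hx : x ∈ prodDom ξ :=
      (objective_ne_top_iff h0).1 (hr.trans_lt (EReal.coe_lt_top r)).ne
    rw [← coe_realObjective h0 hx] at hr
    exact ⟨hx, EReal.coe_le_coe_iff.1 hr⟩

end Objective

/-! ### Weighted Laplacians, the spectral gap and edge flows. -/

section Graph

variable {N : ℕ} (G : SimpleGraph (Fin N)) [DecidableRel G.Adj]

lemma sum_neighborFinset_eq_sum_orientedEdge {M : Type*} [AddCommMonoid M]
    (h : Fin N → Fin N → M) :
    ∑ i, ∑ j ∈ G.neighborFinset i, h i j
      = ∑ e : OrientedEdge G, (h e.1.1 e.1.2 + h e.1.2 e.1.1) := by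
  have h1 : ∀ g : Fin N → Fin N → M, ∑ e : OrientedEdge G, g e.1.1 e.1.2
      = ∑ i, ∑ j, if i < j ∧ G.Adj i j then g i j else 0 := by
    intro g
    rw [← Fintype.sum_prod_type' (f := fun i j => if i < j ∧ G.Adj i j then g i j else 0),
      ← Finset.sum_filter]
    exact (Finset.sum_subtype _ (by simp) (fun e : Fin N × Fin N => g e.1 e.2)).symm
  rw [Finset.sum_add_distrib, h1, h1 fun i j => h j i,
    Finset.sum_comm (f := fun i j => if i < j ∧ G.Adj i j then h j i else 0),
    ← Finset.sum_add_distrib]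
  refine Finset.sum_congr rfl fun i _ => ?_
  rw [← Finset.sum_add_distrib, SimpleGraph.neighborFinset_eq_filter, Finset.sum_filter]
  refine Finset.sum_congr rfl fun j _ => ?_
  by_cases hij : G.Adj i j
  · rcases lt_or_gt_of_ne hij.ne with hlt | hlt
    · simp [hij, hlt, hlt.not_gt]
    · simp [hij, hij.symm, hlt, hlt.not_gt]
  · simp [hij, G.adj_comm j i]

/-- Summation by parts: a weighted Laplacian as a quadratic form on the edges. -/
lemma sum_orientedEdge_inner {V : Type*} [NormedAddCommGroup V] [InnerProductSpace ℝ V]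
    {a : Fin N → Fin N → ℝ} (ha : ∀ i j, a i j = a j i) (x y : Fin N → V) :
    ∑ e : OrientedEdge G, a e.1.1 e.1.2 * inner ℝ (x e.1.1 - x e.1.2) (y e.1.1 - y e.1.2)
      = ∑ i, inner ℝ (∑ j ∈ G.neighborFinset i, a i j • (x i - x j)) (y i) := by
  simp only [sum_inner]
  rw [sum_neighborFinset_eq_sum_orientedEdge]
  refine Finset.sum_congr rfl fun e _ => ?_
  rw [ha e.1.2 e.1.1, inner_smul_left, inner_smul_left, inner_sub_right,
    ← neg_sub (x e.1.1) (x e.1.2), inner_neg_left]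
  simp only [conj_trivial]; ring

/-- The conductance `γᵢ γⱼ / (γᵢ + γⱼ)` of an edge. -/
noncomputable def conductance (γ : Fin N → ℝ) (i j : Fin N) : ℝ := γ i * γ j / (γ i + γ j)

lemma conductance_comm (γ : Fin N → ℝ) (i j : Fin N) :
    conductance γ i j = conductance γ j i := by
  rw [conductance, conductance, mul_comm, add_comm]

lemma conductance_pos {γ : Fin N → ℝ} (hγ : ∀ i, 0 < γ i) (i j : Fin N) :
    0 < conductance γ i j := div_pos (mul_pos (hγ i) (hγ j)) (add_pos (hγ i) (hγ j))

lemma sum_weight_smul {V : Type*} [AddCommGroup V] [Module ℝ V] (γ : Fin N → ℝ)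
    (x : Fin N → V) (i : Fin N) :
    ∑ j ∈ insert i (G.neighborFinset i), weight G γ i j • x j
      = ∑ j ∈ G.neighborFinset i, conductance γ i j • (x i - x j) := by
  rw [Finset.sum_insert (by simp)]
  have h1 : ∑ j ∈ G.neighborFinset i, weight G γ i j • x j
      = - ∑ j ∈ G.neighborFinset i, conductance γ i j • x j := by
    rw [← Finset.sum_neg_distrib]
    refine Finset.sum_congr rfl fun j hj => ?_
    have hij : G.Adj i j := by simpa using hj
    rw [weight, if_neg hij.ne, if_pos hij, neg_smul, conductance]
  rw [h1, weight, if_pos rfl, Finset.sum_smul, ← sub_eq_add_neg, ← Finset.sum_sub_distrib]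
  simp only [smul_sub, conductance]

/-- On an edge with end values `a`, `b`, the difference `γᵢ‖a‖² + γⱼ‖b‖² - γᵢγⱼ/(γᵢ+γⱼ) ‖a - b‖²`
equals `‖γᵢ a + γⱼ b‖² / (γᵢ+γⱼ)`. This is the origin of `γᵢ dᵢ` in the step size condition. -/
lemma sum_conductance_mul_sq_le {V : Type*} [NormedAddCommGroup V] [InnerProductSpace ℝ V]
    {γ : Fin N → ℝ} (hγ : ∀ i, 0 < γ i) (d : Fin N → V) :
    ∑ e : OrientedEdge G, conductance γ e.1.1 e.1.2 * ‖d e.1.1 - d e.1.2‖ ^ 2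
      ≤ ∑ i, γ i * G.degree i * ‖d i‖ ^ 2 := by
  have h1 : ∑ i, γ i * G.degree i * ‖d i‖ ^ 2
      = ∑ i, ∑ j ∈ G.neighborFinset i, γ i * ‖d i‖ ^ 2 := by
    refine Finset.sum_congr rfl fun i _ => ?_
    rw [Finset.sum_const, SimpleGraph.card_neighborFinset_eq_degree, nsmul_eq_mul]; ring
  rw [h1, sum_neighborFinset_eq_sum_orientedEdge G fun i j => γ i * ‖d i‖ ^ 2]
  refine Finset.sum_le_sum fun e _ => ?_
  have hi := hγ e.1.1
  have hj := hγ e.1.2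
  rw [conductance, div_mul_eq_mul_div, div_le_iff₀ (add_pos hi hj), norm_sub_sq_real]
  have h2 := sq_nonneg ‖γ e.1.1 • d e.1.1 + γ e.1.2 • d e.1.2‖
  rw [norm_add_sq_real, norm_smul, norm_smul, inner_smul_left, inner_smul_right,
    Real.norm_of_nonneg hi.le, Real.norm_of_nonneg hj.le] at h2
  simp only [conj_trivial] at h2
  nlinarith

/-- The inverse conductances are the diagonal entries of `Q`, so a coordinate vector tests the
operator norm. -/
lemma le_edgeMatrixNorm {γ : Fin N → ℝ} (hγ : ∀ i, 0 < γ i) (e : OrientedEdge G) :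
    (conductance γ e.1.1 e.1.2)⁻¹ ≤ edgeMatrixNorm G γ := by
  have hi := hγ e.1.1
  have hj := hγ e.1.2
  set T := Matrix.toEuclideanCLM (n := OrientedEdge G) (𝕜 := ℝ) (edgeMatrix G γ) with hT
  have h1 := T.le_opNorm (WithLp.toLp 2 (Pi.single e (1 : ℝ)))
  have h2 : T (WithLp.toLp 2 (Pi.single e (1 : ℝ)))
      = WithLp.toLp 2 (Pi.single e (1 / γ e.1.1 + 1 / γ e.1.2)) := by
    rw [hT, Matrix.toEuclideanCLM_toLp, edgeMatrix]
    simp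
  have h3 : (conductance γ e.1.1 e.1.2)⁻¹ = 1 / γ e.1.1 + 1 / γ e.1.2 := by
    rw [conductance]; field_simp; ring
  rw [h2] at h1
  simp only [PiLp.toLp_single, PiLp.norm_single, norm_one, mul_one] at h1
  rw [h3, edgeMatrixNorm]
  exact (le_abs_self _).trans h1

lemma edgeMatrixNorm_nonneg (γ : Fin N → ℝ) : 0 ≤ edgeMatrixNorm G γ := norm_nonneg _

lemma lapMatrix_mulVec_apply_eq_sum (u : Fin N → ℝ) (i : Fin N) :
    (G.lapMatrix ℝ).mulVec u i = ∑ j ∈ G.neighborFinset i, (u i - u j) := by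
  rw [SimpleGraph.lapMatrix_mulVec_apply, Finset.sum_sub_distrib, Finset.sum_const,
    SimpleGraph.card_neighborFinset_eq_degree, nsmul_eq_mul]

lemma sum_orientedEdge_sq_eq (u : Fin N → ℝ) :
    ∑ e : OrientedEdge G, (u e.1.1 - u e.1.2) ^ 2 = ∑ i, (G.lapMatrix ℝ).mulVec u i * u i := by
  have h := sum_orientedEdge_inner G (a := fun _ _ => 1) (fun _ _ => rfl) u u
  simp only [one_mul, one_smul, RCLike.inner_apply, conj_trivial] at h
  simp only [lapMatrix_mulVec_apply_eq_sum, sq, h]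
  exact Finset.sum_congr rfl fun i _ => mul_comm _ _

lemma nonneg_of_hasEigenvalue_lapMatrix {μ : ℝ}
    (h : Module.End.HasEigenvalue (Matrix.toLin' (G.lapMatrix ℝ)) μ) : 0 ≤ μ := by
  obtain ⟨v, hv⟩ := h.exists_hasEigenvector
  have h1 := hv.apply_eq_smul
  rw [Matrix.toLin'_apply] at h1
  have h2 := sum_orientedEdge_sq_eq G v
  rw [h1] at h2
  simp only [Pi.smul_apply, smul_eq_mul, mul_assoc, ← Finset.mul_sum] at h2
  have h3 : 0 < ∑ i, v i * v i := by
    obtain ⟨i, hi⟩ := Function.ne_iff.1 hv.2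
    exact Finset.sum_pos' (fun i _ => mul_self_nonneg _)
      ⟨i, Finset.mem_univ i, mul_self_pos.2 hi⟩
  refine nonneg_of_mul_nonneg_left (a := μ) ?_ h3
  rw [← h2]
  exact Finset.sum_nonneg fun e _ => sq_nonneg _

lemma sigmaMin_nonneg : 0 ≤ sigmaMin G :=
  Real.sInf_nonneg fun _ hμ => nonneg_of_hasEigenvalue_lapMatrix G hμ.2

/-- In an eigenbasis the two sides are `∑ μₖ aₖ²` and `∑ μₖ² aₖ² / σ_min`, and every eigenvalue is
either `0` or at least `σ_min`. -/
lemma sum_orientedEdge_sq_le (u : Fin N → ℝ) :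
    ∑ e : OrientedEdge G, (u e.1.1 - u e.1.2) ^ 2
      ≤ (∑ i, (G.lapMatrix ℝ).mulVec u i ^ 2) / sigmaMin G := by
  set A := G.lapMatrix ℝ with hA
  have hH : A.IsHermitian := SimpleGraph.isHermitian_lapMatrix ℝ G
  set b := hH.eigenvectorBasis with hb
  set μ := hH.eigenvalues with hμ
  have heig : ∀ k, Module.End.HasEigenvalue (Matrix.toLin' A) (μ k) := fun k =>
    Module.End.hasEigenvalue_of_hasEigenvector (x := WithLp.ofLp (b k))
      ⟨Module.End.mem_eigenspace_iff.2 (by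
        rw [Matrix.toLin'_apply]; exact hH.mulVec_eigenvectorBasis k),
        fun h0 => b.orthonormal.ne_zero k (by ext i; exact congrFun h0 i)⟩
  have hsa : ∀ k, inner ℝ (b k) (WithLp.toLp 2 (A.mulVec u)) = μ k * inner ℝ (b k)
      (WithLp.toLp 2 u) := by
    intro k
    have h1 := hH.mulVec_eigenvectorBasis k
    have hT : A.transpose = A := by simpa [Matrix.IsSymm] using hH
    simp only [EuclideanSpace.inner_eq_star_dotProduct, star_trivial]
    rw [dotProduct_comm, Matrix.dotProduct_mulVec, ← Matrix.mulVec_transpose, hT]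
    change dotProduct (A.mulVec (WithLp.ofLp (hH.eigenvectorBasis k))) u = _
    rw [h1, smul_dotProduct, dotProduct_comm]
    rfl
  have e1 : ∑ i, A.mulVec u i * u i = ∑ k, μ k * inner ℝ (b k) (WithLp.toLp 2 u) ^ 2 := by
    have h := b.sum_inner_mul_inner (WithLp.toLp 2 (A.mulVec u)) (WithLp.toLp 2 u)
    have h' : inner ℝ (WithLp.toLp 2 (A.mulVec u)) (WithLp.toLp 2 u) = ∑ i, A.mulVec u i * u i := by
      rw [PiLp.inner_apply]
      exact Finset.sum_congr rfl fun i _ => by simp [mul_comm]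
    rw [← h', ← h]
    refine Finset.sum_congr rfl fun k _ => ?_
    rw [real_inner_comm, hsa]; ring
  have e2 : ∑ i, A.mulVec u i ^ 2 = ∑ k, μ k ^ 2 * inner ℝ (b k) (WithLp.toLp 2 u) ^ 2 := by
    have h := b.sum_inner_mul_inner (WithLp.toLp 2 (A.mulVec u)) (WithLp.toLp 2 (A.mulVec u))
    have h' : inner ℝ (WithLp.toLp 2 (A.mulVec u)) (WithLp.toLp 2 (A.mulVec u))
        = ∑ i, A.mulVec u i ^ 2 := by
      rw [PiLp.inner_apply]
      exact Finset.sum_congr rfl fun i _ => by simp [sq]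
    rw [← h', ← h]
    refine Finset.sum_congr rfl fun k _ => ?_
    rw [real_inner_comm, hsa]; ring
  rw [sum_orientedEdge_sq_eq, ← hA, e1, e2]
  set M : Set ℝ := {μ : ℝ | μ ≠ 0 ∧ Module.End.HasEigenvalue (Matrix.toLin' A) μ} with hM
  have hσ : sigmaMin G = sInf M := rfl
  have hμ0 : ∀ k, 0 ≤ μ k := fun k => nonneg_of_hasEigenvalue_lapMatrix G (heig k)
  -- Without nonzero eigenvalues `sigmaMin` is the default `sInf ∅ = 0`, and both sides vanish. This
  -- covers the graph with one vertex.
  rcases M.eq_empty_or_nonempty with hempty | hne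
  · have hz : ∀ k, μ k = 0 := fun k => by
      by_contra h0
      exact (Set.eq_empty_iff_forall_notMem.1 hempty) (μ k) ⟨h0, heig k⟩
    simp [hz]
  · have hfin : M.Finite := (Module.End.finite_hasEigenvalue (Matrix.toLin' A)).subset
      fun _ h => h.2
    have hmem : sigmaMin G ∈ M := hσ ▸ hne.csInf_mem hfin
    have hpos : 0 < sigmaMin G := lt_of_le_of_ne (sigmaMin_nonneg G) (Ne.symm hmem.1)
    rw [le_div_iff₀ hpos, Finset.sum_mul]
    refine Finset.sum_le_sum fun k _ => ?_
    rcases eq_or_ne (μ k) 0 with h0 | h0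
    · simp [h0]
    · have h1 : sigmaMin G ≤ μ k := hσ ▸ csInf_le hfin.bddBelow ⟨h0, heig k⟩
      have h2 : 0 ≤ μ k * inner ℝ (b k) (WithLp.toLp 2 u) ^ 2 :=
        mul_nonneg (hμ0 k) (sq_nonneg _)
      nlinarith

variable {G}

/-- The range of a symmetric operator is the orthogonal complement of its kernel, and connectedness
reduces the kernel to the constants. -/
lemma exists_lapMatrix_mulVec_eq (hG : G.Connected) {v : Fin N → ℝ} (hv : ∑ i, v i = 0) :
    ∃ u, (G.lapMatrix ℝ).mulVec u = v := by
  have hT : (Matrix.toEuclideanLin (G.lapMatrix ℝ)).IsSymmetric :=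
    Matrix.isSymmetric_toEuclideanLin_iff.2 (SimpleGraph.isHermitian_lapMatrix ℝ G)
  have hmem : WithLp.toLp 2 v ∈ LinearMap.range (Matrix.toEuclideanLin (G.lapMatrix ℝ)) := by
    rw [← Submodule.orthogonal_orthogonal (LinearMap.range _), hT.orthogonal_range,
      Submodule.mem_orthogonal]
    intro w hw
    have h1 : (G.lapMatrix ℝ).mulVec (WithLp.ofLp w) = 0 := by
      have := congrArg WithLp.ofLp (LinearMap.mem_ker.1 hw)
      simpa using this
    have h2 := (G.lapMatrix_mulVec_eq_zero_iff_forall_reachable).1 h1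
    obtain ⟨i₀⟩ := hG.nonempty
    have h3 : ∀ i, w i = w i₀ := fun i => h2 i i₀ (hG.preconnected i i₀)
    rw [PiLp.inner_apply]
    simp [h3, ← Finset.sum_mul, hv]
  obtain ⟨u, hu⟩ := hmem
  refine ⟨WithLp.ofLp u, ?_⟩
  have := congrArg WithLp.ofLp hu
  simpa using this

/-- A node vector of sum zero is the divergence of an edge flow whose norm is controlled by the
spectral gap. -/
theorem exists_edge_flow (hG : G.Connected) {n : ℕ} {q : Fin N → Vec n} (hq : ∑ i, q i = 0) :
    ∃ θ : OrientedEdge G → Vec n,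
      (∀ y : Fin N → Vec n, ∑ e, inner ℝ (θ e) (y e.1.1 - y e.1.2) = ∑ i, inner ℝ (q i) (y i)) ∧
      ∑ e, ‖θ e‖ ^ 2 ≤ (∑ i, ‖q i‖ ^ 2) / sigmaMin G := by
  have h1 : ∀ l, ∃ u, (G.lapMatrix ℝ).mulVec u = fun i => q i l := fun l =>
    exists_lapMatrix_mulVec_eq hG (by simpa using congrArg (fun z : Vec n => z l) hq)
  choose u hu using h1
  let w : Fin N → Vec n := fun i => WithLp.toLp 2 fun l => u l i
  have hw : ∀ i, ∑ j ∈ G.neighborFinset i, (1 : ℝ) • (w i - w j) = q i := by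
    intro i
    ext l
    have := congrFun (hu l) i
    rw [lapMatrix_mulVec_apply_eq_sum] at this
    simpa [w] using this
  -- The flow is the potential difference of a solution of the unweighted Laplace equation, so the
  -- gap of `Ω` itself appears; the conductances enter only later, through rescaling.
  refine ⟨fun e => w e.1.1 - w e.1.2, fun y => ?_, ?_⟩
  · have := sum_orientedEdge_inner G (a := fun _ _ => 1) (fun _ _ => rfl) w y
    simp only [hw, one_mul] at this
    exact this
  · simp only [EuclideanSpace.norm_sq_eq, Real.norm_eq_abs, sq_abs]
    rw [Finset.sum_comm, Finset.sum_comm (s := Finset.univ (α := Fin N)), Finset.sum_div]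
    refine Finset.sum_le_sum fun l _ => ?_
    have := sum_orientedEdge_sq_le G (u l)
    rw [hu l] at this
    exact this

end Graph

/-! ### The operators `B`, `C`, `K` of the abstract scheme. -/

section Operators

variable {N n : ℕ} (G : SimpleGraph (Fin N)) [DecidableRel G.Adj]

/-- The weighted incidence operator, so that `Bᵀ B` has the entries `Γᵢⱼ`. -/
noncomputable def edgeOp (γ : Fin N → ℝ) :
    (Fin N → Vec n) →ₗ[ℝ] PiLp 2 fun _ : OrientedEdge G => Vec n where
  toFun x := WithLp.toLp 2 fun e => √(conductance γ e.1.1 e.1.2) • (x e.1.1 - x e.1.2)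
  map_add' x y := by ext e : 1; simp only [Pi.add_apply, PiLp.add_apply]; module
  map_smul' a x := by
    ext e : 1; simp only [Pi.smul_apply, PiLp.smul_apply, RingHom.id_apply]; module

/-- The diagonal operator with entries `√aᵢ`. -/
noncomputable def nodeOp (a : Fin N → ℝ) :
    (Fin N → Vec n) →ₗ[ℝ] PiLp 2 fun _ : Fin N => Vec n where
  toFun x := WithLp.toLp 2 fun i => √(a i) • x i
  map_add' x y := by ext i : 1; simp only [Pi.add_apply, PiLp.add_apply]; module
  map_smul' a x := by
    ext i : 1; simp only [Pi.smul_apply, PiLp.smul_apply, RingHom.id_apply]; module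

variable {G} {γ : Fin N → ℝ}

lemma inner_edgeOp (hγ : ∀ i, 0 < γ i) (x y : Fin N → Vec n) :
    inner ℝ (edgeOp G γ x) (edgeOp G γ y) = ∑ e : OrientedEdge G, conductance γ e.1.1 e.1.2
      * inner ℝ (x e.1.1 - x e.1.2) (y e.1.1 - y e.1.2) := by
  rw [PiLp.inner_apply]
  refine Finset.sum_congr rfl fun e _ => ?_
  simp only [edgeOp, LinearMap.coe_mk, AddHom.coe_mk, inner_smul_left, inner_smul_right,
    conj_trivial]
  rw [← mul_assoc, Real.mul_self_sqrt (conductance_pos hγ _ _).le]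

lemma inner_nodeOp {a : Fin N → ℝ} (ha : ∀ i, 0 ≤ a i) (x y : Fin N → Vec n) :
    inner ℝ (nodeOp a x) (nodeOp a y) = ∑ i, a i * inner ℝ (x i) (y i) := by
  rw [PiLp.inner_apply]
  refine Finset.sum_congr rfl fun i _ => ?_
  simp only [nodeOp, LinearMap.coe_mk, AddHom.coe_mk, inner_smul_left, inner_smul_right,
    conj_trivial]
  rw [← mul_assoc, Real.mul_self_sqrt (ha i)]

lemma norm_sq_edgeOp (hγ : ∀ i, 0 < γ i) (x : Fin N → Vec n) :
    ‖edgeOp G γ x‖ ^ 2 = ∑ e : OrientedEdge G, conductance γ e.1.1 e.1.2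
      * ‖x e.1.1 - x e.1.2‖ ^ 2 := by
  rw [← real_inner_self_eq_norm_sq, inner_edgeOp hγ]
  simp only [real_inner_self_eq_norm_sq]

lemma norm_sq_nodeOp {a : Fin N → ℝ} (ha : ∀ i, 0 ≤ a i) (x : Fin N → Vec n) :
    ‖nodeOp a x‖ ^ 2 = ∑ i, a i * ‖x i‖ ^ 2 := by
  rw [← real_inner_self_eq_norm_sq, inner_nodeOp ha]
  simp only [real_inner_self_eq_norm_sq]

omit [DecidableRel G.Adj] in
lemma edgeOp_eq_zero_iff (hγ : ∀ i, 0 < γ i) {x : Fin N → Vec n} :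
    edgeOp G γ x = 0 ↔ IsConsensus G x := by
  have h1 : edgeOp G γ x = 0 ↔ ∀ e : OrientedEdge G, x e.1.1 = x e.1.2 := by
    rw [← WithLp.ofLp_eq_zero, funext_iff]
    refine forall_congr' fun e => ?_
    simp only [edgeOp, LinearMap.coe_mk, AddHom.coe_mk, Pi.zero_apply, smul_eq_zero,
      (Real.sqrt_pos.2 (conductance_pos hγ _ _)).ne', false_or, sub_eq_zero]
  rw [h1]
  refine ⟨fun h i j hij => ?_, fun h e => h _ _ e.2.2⟩
  rcases lt_or_gt_of_ne hij.ne with hlt | hlt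
  · exact h ⟨(i, j), hlt, hij⟩
  · exact (h ⟨(j, i), hlt, hij.symm⟩).symm

/-- An edge flow, rescaled so that it pairs with the weighted incidence operator. -/
noncomputable def scaledFlow (γ : Fin N → ℝ) (θ : OrientedEdge G → Vec n) :
    PiLp 2 fun _ : OrientedEdge G => Vec n :=
  WithLp.toLp 2 fun e => (√(conductance γ e.1.1 e.1.2))⁻¹ • θ e

lemma inner_scaledFlow (hγ : ∀ i, 0 < γ i) (θ : OrientedEdge G → Vec n) (x : Fin N → Vec n) :
    inner ℝ (scaledFlow γ θ) (edgeOp G γ x) = ∑ e, inner ℝ (θ e) (x e.1.1 - x e.1.2) := by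
  rw [PiLp.inner_apply]
  refine Finset.sum_congr rfl fun e _ => ?_
  simp only [scaledFlow, edgeOp, LinearMap.coe_mk, AddHom.coe_mk, inner_smul_left,
    inner_smul_right, conj_trivial]
  rw [← mul_assoc, mul_inv_cancel₀ (Real.sqrt_pos.2 (conductance_pos hγ _ _)).ne', one_mul]

/-- The rescaling multiplies each `‖θ e‖ ^ 2` by an inverse conductance, an entry of `Q`; this is
how `‖Q‖` enters the bounds. -/
lemma norm_sq_scaledFlow_le (hγ : ∀ i, 0 < γ i) (θ : OrientedEdge G → Vec n) :
    ‖scaledFlow γ θ‖ ^ 2 ≤ edgeMatrixNorm G γ * ∑ e, ‖θ e‖ ^ 2 := by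
  rw [PiLp.norm_sq_eq_of_L2, Finset.mul_sum]
  refine Finset.sum_le_sum fun e _ => ?_
  have hpos := conductance_pos hγ e.1.1 e.1.2
  simp only [scaledFlow]
  rw [norm_smul, mul_pow, norm_inv, inv_pow, Real.norm_of_nonneg (Real.sqrt_nonneg _),
    Real.sq_sqrt hpos.le]
  exact mul_le_mul_of_nonneg_right (le_edgeMatrixNorm G hγ e) (sq_nonneg _)

lemma norm_sq_edgeOp_add_le (hγ : ∀ i, 0 < γ i) {a b : Fin N → ℝ} (ha : ∀ i, 0 ≤ a i)
    (hb : ∀ i, 0 ≤ b i) {ε : ℝ} (hε : 0 ≤ ε) (h : ∀ i, ε + a i + γ i * G.degree i ≤ b i)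
    (d : Fin N → Vec n) :
    ε * ‖d‖ ^ 2 + ‖edgeOp G γ d‖ ^ 2 + ‖nodeOp a d‖ ^ 2 ≤ ‖nodeOp b d‖ ^ 2 := by
  have h1 := sum_conductance_mul_sq_le G hγ d
  -- The norm on `Fin N → Vec n` is the supremum norm.
  have h2 : ‖d‖ ^ 2 ≤ ∑ i, ‖d i‖ ^ 2 := by
    have hs : 0 ≤ ∑ i, ‖d i‖ ^ 2 := Finset.sum_nonneg fun i _ => sq_nonneg _
    rw [← Real.le_sqrt (norm_nonneg _) hs, pi_norm_le_iff_of_nonneg (Real.sqrt_nonneg _)]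
    intro i
    rw [Real.le_sqrt (norm_nonneg _) hs]
    exact Finset.single_le_sum (f := fun i => ‖d i‖ ^ 2) (fun i _ => sq_nonneg _)
      (Finset.mem_univ i)
  have h3 := mul_le_mul_of_nonneg_left h2 hε
  have h4 : ∑ i, (ε + a i + γ i * G.degree i) * ‖d i‖ ^ 2 ≤ ∑ i, b i * ‖d i‖ ^ 2 :=
    Finset.sum_le_sum fun i _ => mul_le_mul_of_nonneg_right (h i) (sq_nonneg _)
  simp only [add_mul, Finset.sum_add_distrib, ← Finset.mul_sum] at h4
  rw [norm_sq_edgeOp hγ, norm_sq_nodeOp ha, norm_sq_nodeOp hb]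
  linarith

end Operators

/-! ### DPGA as an instance of the abstract scheme. -/

section Algorithm

variable {N n : ℕ} {G : SimpleGraph (Fin N)} [DecidableRel G.Adj]
  {ξ : Fin N → Vec n → EReal} {f : Fin N → Vec n → ℝ} {U : Fin N → Set (Vec n)} {L : Fin N → ℝ≥0}
  {γ c : Fin N → ℝ} {x0 : Fin N → Vec n} {x s p : ℕ → Fin N → Vec n}

lemma IsDPGA.s_eq (h : IsDPGA G ξ f γ c x0 x s p) (k : ℕ) (i : Fin N) :
    s k i = ∑ j ∈ G.neighborFinset i, conductance γ i j • (x k i - x k j) := by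
  rw [← sum_weight_smul]
  cases k with
  | zero => exact h.s_zero i
  | succ k => exact h.s_succ k i

/-- Since `p⁰ = 0` and the update adds `sᵏ⁺¹`, the accumulated iterates start at `x¹`: the point
`x⁰` contributes only through `s⁰`. This matches `partialSum`. -/
lemma IsDPGA.p_eq (h : IsDPGA G ξ f γ c x0 x s p) (k : ℕ) (i : Fin N) :
    p k i = ∑ j ∈ G.neighborFinset i,
      conductance γ i j • (partialSum x k i - partialSum x k j) := by
  induction k with
  | zero => simp [h.p_zero, partialSum_zero]
  | succ k ih =>
    rw [h.p_succ, ih, h.s_eq, ← Finset.sum_add_distrib, partialSum_succ]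
    refine Finset.sum_congr rfl fun j _ => ?_
    simp only [Pi.add_apply]; module

/-- The nodewise proximal gradient inequalities are summed; summation by parts turns the terms in `p
k i + s k i` into an inner product of images under `edgeOp`. -/
lemma IsDPGA.isLinearizedStep (h : IsDPGA G ξ f γ c x0 x s p) (hγ : ∀ i, 0 < γ i)
    (hc : ∀ i, 0 < c i) (hΦ : ∀ i, IsCompositePair (ξ i) (f i) (U i) (L i))
    (hne : ∀ i, (effDom (ξ i)).Nonempty)
    (hx0 : ∀ i, ∀ y ∈ effDom (ξ i), segment ℝ (x0 i) y ⊆ U i) :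
    IsLinearizedStep (edgeOp G γ) (nodeOp fun i => 1 / c i) (nodeOp fun i => (L i : ℝ))
      (prodDom ξ) (realObjective ξ f) x := by
  -- The hypothesis on segments is needed only at the starting point: every later iterate lies in
  -- the convex set `effDom (ξ i)`, which is contained in `U i`.
  have hstep : ∀ k, ∀ i, ∀ y ∈ effDom (ξ i), segment ℝ (x k i) y ⊆ U i := by
    intro k
    induction k with
    | zero => rw [h.x_zero]; exact hx0
    | succ k ih =>
      intro i y hy
      have hxk := h.x_succ k i
      rw [add_assoc] at hxk
      exact ((hΦ i).nonsmooth.convexOn.1.segment_subset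
        ((hΦ i).prox_step (hne i) (hc i) (ih i) hxk).1 hy).trans (hΦ i).dom_subset
  have key := fun k i => (hΦ i).prox_step (hne i) (hc i) (hstep k i)
    (by have hxk := h.x_succ k i; rw [add_assoc] at hxk; exact hxk)
  refine ⟨fun k i => (key k i).1, fun k y hy => ?_⟩
  have hsum := Finset.sum_le_sum fun i (_ : i ∈ Finset.univ) => (key k i).2 (y i) (hy i)
  rw [← map_add, inner_edgeOp hγ, sum_orientedEdge_inner G (conductance_comm γ),
    inner_nodeOp fun i => (one_div_pos.2 (hc i)).le, 
    norm_sq_nodeOp fun i => NNReal.coe_nonneg (L i)]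
  simp only [Finset.sum_sub_distrib, Finset.sum_add_distrib] at hsum
  have e1 : ∀ i, ∑ j ∈ G.neighborFinset i, conductance γ i j •
      ((partialSum x k + x k) i - (partialSum x k + x k) j) = p k i + s k i := by
    intro i
    rw [h.p_eq, h.s_eq, ← Finset.sum_add_distrib]
    refine Finset.sum_congr rfl fun j _ => ?_
    simp only [Pi.add_apply]; module
  have e2 : 1 / 2 * ∑ i, (L i : ℝ) * ‖(x (k + 1) - x k) i‖ ^ 2
      = ∑ i, (L i : ℝ) / 2 * ‖x (k + 1) i - x k i‖ ^ 2 := by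
    rw [Finset.mul_sum]
    exact Finset.sum_congr rfl fun i _ => by simp only [Pi.sub_apply]; ring
  simp only [e1]
  refine le_trans (le_of_eq ?_) hsum
  rw [e2]
  rfl

end Algorithm

/-! ### Strong duality and the size of the dual optimum. -/

section Saddle

variable {N n : ℕ} {G : SimpleGraph (Fin N)} [DecidableRel G.Adj]
  {ξ : Fin N → Vec n → EReal} {f : Fin N → Vec n → ℝ} {U : Fin N → Set (Vec n)} {L : Fin N → ℝ≥0}
  {γ : Fin N → ℝ} {xstar : Vec n}

lemma IsCentralSolution.mem_prodDom (hΦ : ∀ i, IsCompositePair (ξ i) (f i) (U i) (L i))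
    (hxstar : IsCentralSolution ξ f xstar) (hne : ∃ z, ∀ i, z ∈ effDom (ξ i)) :
    (fun _ => xstar) ∈ prodDom ξ := by
  have h0 : ∀ i, IsClosedConvex (ξ i) := fun i => (hΦ i).nonsmooth
  obtain ⟨z, hz⟩ := hne
  refine (objective_ne_top_iff (f := f) h0).1 ((hxstar z).trans_lt ?_).ne
  exact lt_top_iff_ne_top.2 ((objective_ne_top_iff (x := fun _ => z) h0).2 hz)

lemma IsCentralSolution.optValue_eq (hΦ : ∀ i, IsCompositePair (ξ i) (f i) (U i) (L i))
    (hxstar : IsCentralSolution ξ f xstar) (hmem : (fun _ => xstar) ∈ prodDom ξ) :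
    optValue ξ f = (realObjective ξ f fun _ => xstar : ℝ) := by
  rw [coe_realObjective (fun i => (hΦ i).nonsmooth) hmem]
  exact le_antisymm (iInf_le _ xstar) (le_iInf hxstar)

/-- Strong duality: an optimal dual edge flow, of controlled norm. -/
theorem IsCentralSolution.exists_dual_flow (hG : G.Connected)
    (hΦ : ∀ i, IsCompositePair (ξ i) (f i) (U i) (L i)) (hxstar : IsCentralSolution ξ f xstar)
    (hslater : (⋂ i, intrinsicInterior ℝ (effDom (ξ i))).Nonempty)
    (hmem : (fun _ => xstar) ∈ prodDom ξ) :
    ∃ θ : OrientedEdge G → Vec n,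
      (∀ z ∈ prodDom ξ, realObjective ξ f (fun _ => xstar)
        ≤ realObjective ξ f z + ∑ e, inner ℝ (θ e) (z e.1.1 - z e.1.2)) ∧
      ∀ κ : Fin N → ℝ, (∀ i, ∀ q ∈ subdifferential (composite (ξ i) (f i)) xstar, ‖q‖ ≤ κ i) →
        ∑ e, ‖θ e‖ ^ 2 ≤ (∑ i, κ i ^ 2) / sigmaMin G := by
  have h0 : ∀ i, IsClosedConvex (ξ i) := fun i => (hΦ i).nonsmooth
  obtain ⟨q, hq0, hq⟩ := exists_subgradients_sum_eq_zero (fun i => (hΦ i).convexOn)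
    (xs := xstar) hmem (fun y hy => by
      have h1 := hxstar y
      have h2 := coe_realObjective (f := f) h0 hmem
      have h3 := coe_realObjective (f := f) (x := fun _ => y) h0 hy
      rw [objective] at h2 h3
      rw [← h2, ← h3] at h1
      exact EReal.coe_le_coe_iff.1 h1) hslater
  -- With the sign reversed, pairing the flow with `z` cancels the linear terms of the summed
  -- subgradient inequalities. The norm bound then follows because each `q i` is a subgradient of
  -- `Φᵢ` at `x*`.
  obtain ⟨θ, hθ, hθn⟩ := exists_edge_flow hG (q := fun i => - q i) (by simp [hq0])
  refine ⟨θ, fun z hz => ?_, fun κ hκ => hθn.trans ?_⟩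
  · rw [hθ z]
    have h1 := Finset.sum_le_sum fun i (_ : i ∈ Finset.univ) => hq i (z i) (hz i)
    simp only [inner_sub_right, Finset.sum_add_distrib, Finset.sum_sub_distrib, ← sum_inner, hq0,
      inner_zero_left, sub_zero] at h1
    simp only [inner_neg_left, Finset.sum_neg_distrib, realObjective]
    linarith
  · refine div_le_div_of_nonneg_right (Finset.sum_le_sum fun i _ => ?_) (sigmaMin_nonneg G)
    rw [norm_neg]
    exact pow_le_pow_left₀ (norm_nonneg _)
      (hκ i _ ((h0 i).mem_subdifferential (hmem i) (hq i))) 2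

end Saddle

section Bounds

variable {N n : ℕ} {G : SimpleGraph (Fin N)} [DecidableRel G.Adj] {γ c : Fin N → ℝ}

lemma initialGap_eq (hc : ∀ i, 0 < c i) (xstar : Vec n) (x0 : Fin N → Vec n) :
    initialGap c xstar x0 = 1 / 2 * ‖nodeOp (fun i => 1 / c i) ((fun _ => xstar) - x0)‖ ^ 2 := by
  rw [norm_sq_nodeOp fun i => (one_div_pos.2 (hc i)).le, initialGap, Finset.mul_sum]
  refine Finset.sum_congr rfl fun i _ => ?_
  simp only [Pi.sub_apply]
  field_simp

end Bounds

end DPGA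

/-! ### Choice of multipliers and assembly of the three claims. -/

theorem mainTheorem4 {N n : ℕ} (G : SimpleGraph (Fin N)) [DecidableRel G.Adj]
    (hG : G.Connected)
    (ξ : Fin N → DPGA.Vec n → EReal) (f : Fin N → DPGA.Vec n → ℝ)
    (U : Fin N → Set (DPGA.Vec n)) (L : Fin N → ℝ≥0)
    (hΦ : ∀ i, DPGA.IsCompositePair (ξ i) (f i) (U i) (L i))
    (xstar : DPGA.Vec n) (hxstar : DPGA.IsCentralSolution ξ f xstar)
    (hslater : (⋂ i, intrinsicInterior ℝ (DPGA.effDom (ξ i))).Nonempty)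
    (γ : Fin N → ℝ) (hγ : ∀ i, 0 < γ i)
    (c : Fin N → ℝ) (hc : ∀ i, 0 < c i)
    (hstep : ∀ i, c i * ((L i : ℝ) + γ i * (G.degree i : ℝ)) ≤ 1)
    (x0 : Fin N → DPGA.Vec n)
    (hx0 : ∀ i, ∀ y ∈ DPGA.effDom (ξ i), segment ℝ (x0 i) y ⊆ U i)
    (x s p : ℕ → Fin N → DPGA.Vec n) (hrun : DPGA.IsDPGA G ξ f γ c x0 x s p) :
    ((∀ i, c i * ((L i : ℝ) + γ i * (G.degree i : ℝ)) < 1) →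
      ∃ xlim : Fin N → DPGA.Vec n, DPGA.IsDistributedSolution G ξ f xlim ∧
        Filter.Tendsto x Filter.atTop (nhds xlim)) ∧
    (∀ t : ℕ, 1 ≤ t →
      DPGA.objective ξ f (DPGA.average x t) - DPGA.optValue ξ f ≤
        ((1 / (t : ℝ) * DPGA.initialGap c xstar x0 : ℝ) : EReal)) ∧
    (∀ κ : Fin N → ℝ, (∀ i, 0 < κ i) →
      (∀ i, ∀ q ∈ DPGA.subdifferential (DPGA.composite (ξ i) (f i)) xstar, ‖q‖ ≤ κ i) →
      ∀ t : ℕ, 1 ≤ t →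
        ((-(1 / (t : ℝ) * (2 * DPGA.edgeMatrixNorm G γ / DPGA.sigmaMin G * (∑ i, κ i ^ 2) +
            DPGA.initialGap c xstar x0)) : ℝ) : EReal) ≤
          DPGA.objective ξ f (DPGA.average x t) - DPGA.optValue ξ f ∧
        DPGA.consensusViolation G (DPGA.average x t) ≤
          1 / (t : ℝ) * (DPGA.edgeMatrixNorm G γ * ((∑ i, κ i ^ 2 / DPGA.sigmaMin G) + 1) +
            DPGA.initialGap c xstar x0)) := by
  have h0 : ∀ i, DPGA.IsClosedConvex (ξ i) := fun i => (hΦ i).nonsmooth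
  have hne : ∃ z, ∀ i, z ∈ DPGA.effDom (ξ i) := by
    obtain ⟨z, hz⟩ := hslater
    exact ⟨z, fun i => intrinsicInterior_subset (Set.mem_iInter.1 hz i)⟩
  have hmem := hxstar.mem_prodDom hΦ hne
  have hopt := hxstar.optValue_eq hΦ hmem
  have hlin := hrun.isLinearizedStep hγ hc hΦ (fun i => hne.imp fun z hz => hz i) hx0
  have hcons : DPGA.edgeOp G γ (fun _ => xstar) = 0 :=
    (DPGA.edgeOp_eq_zero_iff hγ).2 fun _ _ _ => rfl
  obtain ⟨θ, hθ, hθn⟩ := hxstar.exists_dual_flow hG hΦ hslater hmem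
  have hnorm : ∀ ε : ℝ, 0 ≤ ε → (∀ i, ε + (L i : ℝ) + γ i * G.degree i ≤ 1 / c i) →
      ∀ d : Fin N → DPGA.Vec n, ε * ‖d‖ ^ 2 + ‖DPGA.edgeOp G γ d‖ ^ 2
        + ‖DPGA.nodeOp (fun i => (L i : ℝ)) d‖ ^ 2 ≤ ‖DPGA.nodeOp (fun i => 1 / c i) d‖ ^ 2 :=
    fun ε hε h d => DPGA.norm_sq_edgeOp_add_le hγ (fun i => NNReal.coe_nonneg (L i))
      (fun i => (one_div_pos.2 (hc i)).le) hε h d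
  have hflow : ∀ t : ℕ, 1 ≤ t → DPGA.average x t ∈ DPGA.prodDom ξ ∧
      ∀ θ' : DPGA.OrientedEdge G → DPGA.Vec n,
        DPGA.realObjective ξ f (DPGA.average x t) - DPGA.realObjective ξ f (fun _ => xstar)
          + ∑ e, inner ℝ (θ' e) (DPGA.average x t e.1.1 - DPGA.average x t e.1.2)
        ≤ 1 / (t : ℝ) * (DPGA.initialGap c xstar x0
          + 1 / 2 * (DPGA.edgeMatrixNorm G γ * ∑ e, ‖θ' e‖ ^ 2)) := by
    intro t ht
    have hav : DPGA.average x t = (t : ℝ)⁻¹ • ∑ k ∈ Finset.Icc 1 t, x k := by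
      ext1 i
      simp [DPGA.average]
    have herg := fun μ => hlin.ergodic_bound (fun d => by
      have := hnorm 0 le_rfl (fun i => by
        rw [zero_add, le_div_iff₀ (hc i), mul_comm]; exact hstep i) d
      linarith) (DPGA.convexOn_realObjective hΦ) hmem hcons μ ht
    rw [← hav] at herg
    refine ⟨(herg 0).1, fun θ' => ?_⟩
    have h1 := (herg (DPGA.scaledFlow γ θ')).2
    rw [DPGA.inner_scaledFlow hγ, hrun.x_zero, ← DPGA.initialGap_eq hc] at h1
    refine h1.trans (mul_le_mul_of_nonneg_left ?_ (by positivity))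
    linarith [DPGA.norm_sq_scaledFlow_le hγ θ']
  have hobj : ∀ t : ℕ, 1 ≤ t → DPGA.objective ξ f (DPGA.average x t) - DPGA.optValue ξ f
      = ((DPGA.realObjective ξ f (DPGA.average x t)
        - DPGA.realObjective ξ f (fun _ => xstar) : ℝ) : EReal) := by
    intro t ht
    rw [hopt, ← DPGA.coe_realObjective h0 (hflow t ht).1, EReal.coe_sub]
  refine ⟨fun hstrict => ?_, fun t ht => ?_, fun κ _ hκ t ht => ?_⟩
  -- Finitely many strict inequalities leave a common margin `ε`, which is the strong positivity
  -- needed for convergence.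
  · obtain ⟨ε, hε, hεc⟩ : ∃ ε : ℝ, 0 < ε ∧
        ∀ i, ε + (L i : ℝ) + γ i * G.degree i ≤ 1 / c i := by
      have h1 : ∀ᶠ ε in nhdsWithin (0 : ℝ) (Set.Ioi 0),
          ∀ i, ε + (L i : ℝ) + γ i * G.degree i ≤ 1 / c i := by
        rw [Filter.eventually_all]
        intro i
        have h2 : 0 < 1 / c i - ((L i : ℝ) + γ i * G.degree i) := by
          rw [sub_pos, lt_div_iff₀ (hc i), mul_comm]; exact hstrict i
        filter_upwards [Ioo_mem_nhdsGT h2] with ε hε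
        linarith [hε.2]
      obtain ⟨ε, hεc, hε⟩ := (h1.and self_mem_nhdsWithin).exists
      exact ⟨ε, hε, hεc⟩
    obtain ⟨xlim, hmemlim, hB, hmin, hlim⟩ := hlin.exists_tendsto hε (hnorm ε hε.le hεc)
      (DPGA.isClosed_epigraph_realObjective hΦ) (y := fun _ => xstar)
      (μ := DPGA.scaledFlow γ θ) ⟨hmem, hcons, fun z hz => by
        rw [DPGA.inner_scaledFlow hγ]; exact hθ z hz⟩
    refine ⟨xlim, ⟨(DPGA.edgeOp_eq_zero_iff hγ).1 hB, fun y hy => ?_⟩, hlim⟩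
    by_cases hyD : y ∈ DPGA.prodDom ξ
    · rw [← DPGA.coe_realObjective h0 hmemlim, ← DPGA.coe_realObjective h0 hyD]
      exact EReal.coe_le_coe_iff.2 (hmin y hyD ((DPGA.edgeOp_eq_zero_iff hγ).2 hy))
    · rw [not_not.1 (mt (DPGA.objective_ne_top_iff h0).1 hyD)]
      exact le_top
  · rw [hobj t ht]
    refine EReal.coe_le_coe_iff.2 ?_
    simpa using (hflow t ht).2 0
  · have ht0 : (0 : ℝ) < t := by exact_mod_cast ht
    have hQ := DPGA.edgeMatrixNorm_nonneg G γ
    have hsaddle := hθ _ (hflow t ht).1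
    have hn := mul_le_mul_of_nonneg_left (hθn κ hκ) hQ
    set R := (∑ i, κ i ^ 2) / DPGA.sigmaMin G with hR
    constructor
    · rw [hobj t ht]
      refine EReal.coe_le_coe_iff.2 ?_
      -- The saddle inequality bounds the pairing with `θ` below by `-(F - F*)`. Doubling the
      -- multiplier therefore leaves `-(F - F*)` on the left, at the price `1/2 * ‖Q‖ * 4 ∑ ‖θ‖²`.
      have h1 := (hflow t ht).2 ((2 : ℝ) • θ)
      simp only [Pi.smul_apply, inner_smul_left, norm_smul, mul_pow, ← Finset.mul_sum,
        conj_trivial, Real.norm_ofNat] at h1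
      have h2 : 1 / (t : ℝ) * (DPGA.initialGap c xstar x0
          + 1 / 2 * (DPGA.edgeMatrixNorm G γ * (2 ^ 2 * ∑ e, ‖θ e‖ ^ 2)))
          ≤ 1 / (t : ℝ) * (2 * DPGA.edgeMatrixNorm G γ / DPGA.sigmaMin G * (∑ i, κ i ^ 2)
            + DPGA.initialGap c xstar x0) := by
        refine mul_le_mul_of_nonneg_left ?_ (by positivity)
        have : 2 * DPGA.edgeMatrixNorm G γ / DPGA.sigmaMin G * (∑ i, κ i ^ 2)
            = 2 * (DPGA.edgeMatrixNorm G γ * R) := by rw [hR]; ring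
        rw [this]
        linarith
      linarith
    · rw [← Finset.sum_div, ← hR]
      set v : DPGA.OrientedEdge G → DPGA.Vec n :=
        fun e => DPGA.average x t e.1.1 - DPGA.average x t e.1.2 with hv
      set r := DPGA.consensusViolation G (DPGA.average x t) with hr
      have hr0 : 0 ≤ r := Real.sqrt_nonneg _
      have hr2 : ∑ e, ‖v e‖ ^ 2 = r ^ 2 :=
        (Real.sq_sqrt (Finset.sum_nonneg fun e _ => sq_nonneg _)).symm
      -- The unit vector along the consensus error is added to the dual optimum: its pairing with
      -- the error is `r`, and the part with `θ` is nonnegative together with `F - F*`. For `r = 0`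
      -- the convention `0⁻¹ = 0` keeps the identities valid.
      have h1 := (hflow t ht).2 fun e => θ e + r⁻¹ • v e
      have h2 : ∑ e, inner ℝ (θ e + r⁻¹ • v e) (v e) = ∑ e, inner ℝ (θ e) (v e) + r := by
        simp only [inner_add_left, inner_smul_left, Finset.sum_add_distrib, ← Finset.mul_sum,
          real_inner_self_eq_norm_sq, hr2, conj_trivial]
        rcases hr0.eq_or_lt with h | h
        · simp [← h]
        · field_simp
      -- From `‖a + b‖² ≤ 2‖a‖² + 2‖b‖²`; the factors `2` cancel the `1/2` in `hflow` and give `R +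
      -- 1`.
      have h3 : ∑ e, ‖θ e + r⁻¹ • v e‖ ^ 2 ≤ 2 * ∑ e, ‖θ e‖ ^ 2 + 2 := by
        have h4 : ∑ e, ‖θ e + r⁻¹ • v e‖ ^ 2
            ≤ ∑ e, (2 * ‖θ e‖ ^ 2 + 2 * ((r⁻¹) ^ 2 * ‖v e‖ ^ 2)) := by
          refine Finset.sum_le_sum fun e _ => ?_
          have h5 := norm_add_le (θ e) (r⁻¹ • v e)
          have h6 : ‖r⁻¹ • v e‖ ^ 2 = (r⁻¹) ^ 2 * ‖v e‖ ^ 2 := by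
            rw [norm_smul, mul_pow, Real.norm_eq_abs, sq_abs]
          rw [← h6]
          nlinarith [sq_nonneg (‖θ e‖ - ‖r⁻¹ • v e‖), norm_nonneg (θ e + r⁻¹ • v e)]
        rw [Finset.sum_add_distrib, ← Finset.mul_sum, ← Finset.mul_sum, ← Finset.mul_sum,
          hr2] at h4
        have h7 : (r⁻¹) ^ 2 * r ^ 2 ≤ 1 := by
          rw [← mul_pow]
          rcases hr0.eq_or_lt with h | h
          · simp [← h]
          · rw [inv_mul_cancel₀ h.ne']; norm_num
        linarith
      rw [h2] at h1
      have h8 : 1 / (t : ℝ) * (DPGA.initialGap c xstar x0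
          + 1 / 2 * (DPGA.edgeMatrixNorm G γ * ∑ e, ‖θ e + r⁻¹ • v e‖ ^ 2))
          ≤ 1 / (t : ℝ) * (DPGA.edgeMatrixNorm G γ * (R + 1) + DPGA.initialGap c xstar x0) := by
        refine mul_le_mul_of_nonneg_left ?_ (by positivity)
        have := mul_le_mul_of_nonneg_left h3 hQ
        linarith
      linarith
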